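/- Let $\mathbb{M}$ be the space of locally finite subsets of $\mathbb{R}$ (sets having finitely many points in every compact set), endowed with the smallest $\sigma$-algebra for which the maps $S \mapsto \#(S\cap B)$ are measurable for all Borel $B\subseteq\mathbb{R}$. A Poisson process of intensity $\lambda>0$ on $\mathbb{R}$ is a random element $X$ of $\mathbb{M}$ such that $\#(X\cap B)$ is Poisson distributed with mean $\lambda|B|$ for every Borel set $B$ of finite Lebesgue measure $|B|$, and such that $\#(X\cap B_1),\dots,\#(X\cap B_n)$ are independent for pairwise disjoint Borel sets $B_1,\dots,B_n$. For $\lambda'>\lambda>0$, a measurable function $f:\mathbb{M}\to\mathbb{M}$ is called a thickening from intensity $\lambda$ to $\lambda'$ if $X\cup f(X)$ is a Poisson process of intensity $\lambda'$ whenever $X$ is a Poisson process of intensity $\lambda$; it is called equivariant if $f(S+t)=f(S)+t$ for all $S\in\mathbb{M}$ and $t\in\mathbb{R}$. Theorem. For all $\lambda'>\lambda>0$ there is no equivariant thickening from intensity $\lambda$ to intensity $\lambda'$. -/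

import Mathlib

open MeasureTheory ProbabilityTheory
open scoped NNReal

/-- The space `𝕄` of locally finite subsets of `ℝ`: those with finitely many points in every
compact set. -/
structure LocFinSet where
  /-- The underlying set of points. -/
  carrier : Set ℝ
  finite_inter : ∀ K : Set ℝ, IsCompact K → (carrier ∩ K).Finite

namespace LocFinSet

/-- The number of points of `S` that lie in `B` (possibly `∞`). -/
noncomputable def count (B : Set ℝ) (S : LocFinSet) : ℕ∞ := (S.carrier ∩ B).encard

/-- The standard σ-algebra on `𝕄`: the smallest one for which all the counting maps
`S ↦ #(S ∩ B)`, with `B ⊆ ℝ` Borel, are measurable. -/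
noncomputable instance : MeasurableSpace LocFinSet :=
  ⨆ (B : Set ℝ) (_ : MeasurableSet B), MeasurableSpace.comap (count B) inferInstance

/-- The union of two locally finite sets. -/
instance : Union LocFinSet where
  union S T := ⟨S.carrier ∪ T.carrier, fun K hK => by
    rw [Set.union_inter_distrib_right]
    exact (S.finite_inter K hK).union (T.finite_inter K hK)⟩

/-- The shift of `ℝ` by `t`, acting on locally finite sets: `S ↦ S + t`. -/
def shift (t : ℝ) (S : LocFinSet) : LocFinSet :=
  ⟨(fun x => x + t) '' S.carrier, fun K hK => by
    have h := (S.finite_inter ((fun x => x - t) '' K)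
      (hK.image (continuous_id.sub continuous_const))).image (fun x => x + t)
    refine h.subset ?_
    rintro _ ⟨⟨x, hx, rfl⟩, hK'⟩
    exact ⟨x, ⟨hx, x + t, hK', add_sub_cancel_right x t⟩, rfl⟩⟩

end LocFinSet

/-- The random element `X` of `𝕄` is a (homogeneous) Poisson process of intensity `lam` on `ℝ`:
the number of points in a Borel set `B` of finite Lebesgue measure `|B|` is Poisson distributed
with mean `lam * |B|`, and the numbers of points in disjoint Borel sets are independent. -/
structure IsPoissonProcess {Ω : Type*} [MeasurableSpace Ω] (X : Ω → LocFinSet) (lam : ℝ≥0)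
    (P : Measure Ω) : Prop where
  measurable : Measurable X
  hasLaw_count : ∀ B : Set ℝ, MeasurableSet B → volume B ≠ ⊤ →
    HasLaw (fun ω => (X ω).count B)
      ((poissonMeasure (lam * (volume B).toNNReal)).map (Nat.cast : ℕ → ℕ∞)) P
  indep_count : ∀ (n : ℕ) (B : Fin n → Set ℝ), (∀ i, MeasurableSet (B i)) →
    (∀ i j, i ≠ j → Disjoint (B i) (B j)) →
    iIndepFun (fun i ω => (X ω).count (B i)) P

/-- `f : 𝕄 → 𝕄` is a thickening from intensity `lam` to intensity `lam'`: it is measurable, and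
`X ∪ f(X)` is a Poisson process of intensity `lam'` whenever `X` is a Poisson process of
intensity `lam`. As both conditions concern only the law of `X` on `LocFinSet : Type`, it is
enough to let the probability space `Ω` range over `Type`. -/
structure IsThickening (f : LocFinSet → LocFinSet) (lam lam' : ℝ≥0) : Prop where
  measurable : Measurable f
  isPoissonProcess : ∀ (Ω : Type) [MeasurableSpace Ω] (P : Measure Ω) [IsProbabilityMeasure P]
    (X : Ω → LocFinSet), IsPoissonProcess X lam P →
    IsPoissonProcess (fun ω => X ω ∪ f (X ω)) lam' P

/-- `f : 𝕄 → 𝕄` is equivariant: it commutes with every shift of `ℝ`. -/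
def IsEquivariant (f : LocFinSet → LocFinSet) : Prop :=
  ∀ t : ℝ, LocFinSet.shift t ∘ f = f ∘ LocFinSet.shift t

/-!
The proof compares entropies. Let `X` be a Poisson process of intensity `lam` and suppose that
`Y = X ∪ f(X)` is Poisson of intensity `lam' > lam`, with `f` equivariant. Fix a coarse mesh `ε`, and
let `η = ε / 2 ^ j` be a fine mesh with `j → ∞`. Per unit length, the occupation bits of the fine
cells have entropy `lam log (1 / η) + O(1)` for `X` and `lam' log (1 / η) + O(1)` for `Y`. On the
other hand `Y` on the fine grid can be encoded as follows.

* Write down the fine bits of `X`, at the cost `lam log (1 / η) + O(1)`.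
* Write down the coarse bits of `Y`. As `Y` is a measurable function of `X`, the coarse bit of one
  cell is predicted, up to a small error, by finitely many fine bits of `X`
  (`LocFinSet.exists_bits_approx`). By equivariance and stationarity the same predictor serves all
  cells (`exists_predictor`), so that this cost is negligible.
* In each occupied coarse cell, point out the fine cells that `Y` occupies and `X` does not, at the
  cost `log (ε / η)` each, which makes `(lam' - lam) log (ε / η) + O(1)`.

The total is `lam' log (1 / η) - (lam' - lam) log (1 / ε) + O(1)`, where the `O(1)` does not depend on
`ε`; for small `ε` this is less than the entropy of `Y`, which is impossible.

Instead of conditional entropies, the proof uses Gibbs' inequality in the form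
`integral_log_le_integral_log`: an explicit product of subprobability weights for the fine bits of
`X` and `Y` (`sum_bernWeight_mul_blockWeight_le`) gives the bound `entropy_inequality` for `K` coarse
cells. The theorem follows by letting first `K` and then `j` tend to infinity.

That the fine occupation bits determine a locally finite set, as far as measurability is concerned,
is `LocFinSet.iSup_gridAlgebra`; it also yields that the law of a Poisson process is determined by its
intensity (`IsPoissonProcess.map_eq`), hence stationary. Since a thickening is only constrained
by the Poisson processes that exist, a Poisson process has to be constructed
(`PoissonConstruction.isPoissonProcess_process`): independently in each interval `[k, k + 1)`, take a
Poisson number of independent uniform points.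
-/

/-! ### Grids of cells and occupation bits -/

/-- The half-open interval `[i η, (i + 1) η)`, the `i`-th cell of the grid of mesh `η`. -/
def cell (η : ℝ) (i : ℤ) : Set ℝ := Set.Ico (i * η) ((i + 1) * η)

lemma measurableSet_cell (η : ℝ) (i : ℤ) : MeasurableSet (cell η i) := measurableSet_Ico

lemma volume_cell (η : ℝ) (i : ℤ) : volume (cell η i) = ENNReal.ofReal η := by
  rw [cell, Real.volume_Ico]; congr 1; ring

lemma mem_cell_iff {η : ℝ} (hη : 0 < η) {i : ℤ} {x : ℝ} : x ∈ cell η i ↔ ⌊x / η⌋ = i := by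
  rw [Int.floor_eq_iff, le_div_iff₀ hη, div_lt_iff₀ hη]; rfl

lemma disjoint_cell {η : ℝ} (hη : 0 < η) {i j : ℤ} (hij : i ≠ j) :
    Disjoint (cell η i) (cell η j) := by
  rw [Set.disjoint_left]
  intro x hx hx'
  rw [mem_cell_iff hη] at hx hx'
  exact hij (hx ▸ hx')

lemma cell_eq_iUnion {η : ℝ} (hη : 0 < η) {m : ℕ} (hm : 0 < m) (i : ℤ) :
    cell η i = ⋃ l : Fin m, cell (η / m) (i * m + (l : ℕ)) := by
  have hm' : (0 : ℝ) < m := by exact_mod_cast hm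
  have hmz : (0 : ℤ) < m := by exact_mod_cast hm
  ext x
  simp only [Set.mem_iUnion, mem_cell_iff hη, mem_cell_iff (div_pos hη hm')]
  have h1 : ⌊x / η⌋ = ⌊x / (η / m)⌋ / (m : ℤ) := by
    rw [← Int.floor_div_natCast]; congr 1; field_simp
  rw [h1]
  generalize ⌊x / (η / m)⌋ = z
  constructor
  · rintro rfl
    refine ⟨⟨(z % m).toNat, ?_⟩, ?_⟩
    · have := Int.emod_lt_of_pos z hmz
      have := Int.emod_nonneg z hmz.ne'
      omega
    · have := Int.emod_nonneg z hmz.ne'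
      have h2 := Int.mul_ediv_add_emod z m
      simp only [Int.toNat_of_nonneg this]
      linarith [mul_comm (m : ℤ) (z / m)]
  · rintro ⟨l, rfl⟩
    rw [add_comm, Int.add_mul_ediv_right _ _ hmz.ne', Int.ediv_eq_zero_of_lt (by positivity)
      (by exact_mod_cast l.2), zero_add]

namespace LocFinSet

lemma measurable_count {B : Set ℝ} (hB : MeasurableSet B) : Measurable (count B) :=
  Measurable.of_comap_le (le_iSup₂_of_le (f := fun (B : Set ℝ) (_ : MeasurableSet B) =>
    MeasurableSpace.comap (count B) inferInstance) B hB le_rfl)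

lemma measurable_of_count {Ω : Type*} {m : MeasurableSpace Ω} {X : Ω → LocFinSet}
    (h : ∀ B, MeasurableSet B → Measurable fun ω => (X ω).count B) : Measurable X := by
  rw [measurable_iff_comap_le]
  simp only [instMeasurableSpace, MeasurableSpace.comap_iSup, MeasurableSpace.comap_comp]
  exact iSup₂_le fun B hB => (h B hB).comap_le

/-- The occupation bit of the cell `cell η i`: whether `S` has a point there. -/
noncomputable def occ (η : ℝ) (S : LocFinSet) (i : ℤ) : Bool :=
  open Classical in decide (S.carrier ∩ cell η i).Nonempty

lemma occ_eq_true {η : ℝ} {S : LocFinSet} {i : ℤ} :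
    occ η S i = true ↔ (S.carrier ∩ cell η i).Nonempty := by simp [occ]

lemma count_eq_zero {S : LocFinSet} {B : Set ℝ} : S.count B = 0 ↔ ¬ (S.carrier ∩ B).Nonempty := by
  rw [count, Set.encard_eq_zero, Set.not_nonempty_iff_eq_empty]

lemma occ_eq (η : ℝ) (S : LocFinSet) (i : ℤ) : occ η S i = !decide (S.count (cell η i) = 0) := by
  rw [Bool.eq_iff_iff, occ_eq_true]
  simp [count_eq_zero]

lemma measurable_occ (η : ℝ) (i : ℤ) : Measurable fun S => occ η S i := by
  simp_rw [occ_eq]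
  exact (Measurable.of_discrete (f := fun n : ℕ∞ => !decide (n = 0))).comp
    (measurable_count (measurableSet_cell η i))

lemma occ_eq_true_iff_exists {η : ℝ} (hη : 0 < η) {m : ℕ} (hm : 0 < m) (S : LocFinSet) (i : ℤ) :
    occ η S i = true ↔ ∃ l : Fin m, occ (η / m) S (i * m + (l : ℕ)) = true := by
  simp only [occ_eq_true]
  rw [cell_eq_iUnion hη hm i, Set.inter_iUnion, Set.nonempty_iUnion]

/-! ### Occupation bits generate the σ-algebra -/

/-- The cells of mesh `ε / 2 ^ j` (given by their indices) that make up `[-j ε, j ε)`. -/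
noncomputable def window (j : ℕ) : Finset ℤ := Finset.Ico (-(j * 2 ^ j : ℤ)) (j * 2 ^ j)

/-- The occupation bits of `S` in the cells of mesh `ε / 2 ^ j` that make up `[-j ε, j ε)`. -/
noncomputable def bits (ε : ℝ) (j : ℕ) (S : LocFinSet) : window j → Bool :=
  fun i => occ (ε / 2 ^ j) S i

/-- The finite σ-algebra generated by the occupation bits `bits ε j`. -/
@[reducible] noncomputable def gridAlgebra (ε : ℝ) (j : ℕ) : MeasurableSpace LocFinSet :=
  MeasurableSpace.comap (bits ε j) ⊤

lemma measurableSet_gridAlgebra {ε : ℝ} {j : ℕ} {s : Set LocFinSet} :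
    MeasurableSet[gridAlgebra ε j] s ↔ ∃ T : Set (window j → Bool), bits ε j ⁻¹' T = s :=
  ⟨fun ⟨T, _, h⟩ => ⟨T, h⟩, fun ⟨T, h⟩ => ⟨T, trivial, h⟩⟩

lemma measurable_bits (ε : ℝ) (j : ℕ) : Measurable (bits ε j) :=
  measurable_pi_lambda _ fun _ => measurable_occ _ _

lemma gridAlgebra_le (ε : ℝ) (j : ℕ) : gridAlgebra ε j ≤ instMeasurableSpace := by
  rintro s ⟨T, -, rfl⟩
  exact measurable_bits ε j (Set.toFinite T).measurableSet

/-- A coarse cell inside the window at level `j'` is a union of cells of that window, so its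
occupation bit is measurable at level `j'`. -/
lemma measurableSet_gridAlgebra_occ {ε : ℝ} (hε : 0 < ε) {j j' : ℕ} (hj : j ≤ j') {i : ℤ}
    (h1 : -(j' * 2 ^ j : ℤ) ≤ i) (h2 : i < j' * 2 ^ j) :
    MeasurableSet[gridAlgebra ε j'] {S | occ (ε / 2 ^ j) S i = true} := by
  obtain ⟨d, rfl⟩ := Nat.exists_eq_add_of_le hj
  have hm : 0 < 2 ^ d := by positivity
  have key : ∀ l : Fin (2 ^ d), i * (2 ^ d : ℕ) + (l : ℕ) ∈ window (j + d) := by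
    intro l
    have hl : ((l : ℕ) : ℤ) + 1 ≤ (2 ^ d : ℕ) := by exact_mod_cast l.2
    have hl0 : (0 : ℤ) ≤ (l : ℕ) := by positivity
    have hp : (0 : ℤ) < (2 ^ d : ℕ) := by exact_mod_cast hm
    rw [window, Finset.mem_Ico]
    push_cast at *
    constructor
    · rw [pow_add]; nlinarith
    · rw [pow_add]; nlinarith
  rw [measurableSet_gridAlgebra]
  refine ⟨{b | ∃ l : Fin (2 ^ d), b ⟨_, key l⟩ = true}, ?_⟩
  ext S
  simp only [Set.mem_preimage, Set.mem_ofPred_eq]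
  rw [occ_eq_true_iff_exists (by positivity) hm]
  simp [bits, pow_add, div_div]

lemma gridAlgebra_mono {ε : ℝ} (hε : 0 < ε) : Monotone (gridAlgebra ε) := by
  intro j j' hj
  have h : Measurable[gridAlgebra ε j'] (bits ε j) := by
    refine @measurable_pi_lambda _ _ _ (gridAlgebra ε j') _ _ fun i => ?_
    have hi := Finset.mem_Ico.1 i.2
    have hjz : (j : ℤ) ≤ j' := by exact_mod_cast hj
    have hp : (0 : ℤ) < 2 ^ j := by positivity
    refine @measurable_to_bool _ (gridAlgebra ε j') _ ?_
    exact measurableSet_gridAlgebra_occ hε hj (by nlinarith) (by nlinarith)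
  rintro s ⟨T, -, rfl⟩
  exact h (Set.toFinite T).measurableSet

lemma measurableSet_iSup_gridAlgebra_occ {ε : ℝ} (hε : 0 < ε) (j : ℕ) (i : ℤ) :
    MeasurableSet[⨆ j, gridAlgebra ε j] {S | occ (ε / 2 ^ j) S i = true} := by
  have hp : (1 : ℤ) ≤ 2 ^ j := one_le_pow₀ (by norm_num)
  have h0 : (0 : ℤ) ≤ (j : ℕ) := by positivity
  refine (le_iSup (gridAlgebra ε) (j + i.natAbs + 1)) _
    (measurableSet_gridAlgebra_occ hε (by omega) ?_ ?_)
  · push_cast; nlinarith [abs_nonneg i, neg_abs_le i]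
  · push_cast; nlinarith [abs_nonneg i, le_abs_self i]

/-- A locally finite set has at least `m` points in an open set `U` if and only if, on some dyadic
grid, at least `m` cells contained in `U` are occupied. -/
lemma natCast_le_count_iff {ε : ℝ} (hε : 0 < ε) {U : Set ℝ} (hU : IsOpen U) (m : ℕ)
    (S : LocFinSet) : (m : ℕ∞) ≤ S.count U ↔ ∃ (j : ℕ) (T : Finset ℤ), T.card = m ∧
      ∀ i ∈ T, cell (ε / 2 ^ j) i ⊆ U ∧ occ (ε / 2 ^ j) S i = true := by
  have hη : ∀ j : ℕ, 0 < ε / 2 ^ j := fun j => by positivity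
  constructor
  · intro h
    obtain ⟨t, hts, htc⟩ := Set.exists_subset_encard_eq h
    have htf : t.Finite := Set.finite_of_encard_eq_coe htc
    have hlim : Filter.Tendsto (fun j : ℕ => ε / 2 ^ j) Filter.atTop (nhds 0) :=
      tendsto_const_nhds.div_atTop (tendsto_pow_atTop_atTop_of_one_lt (by norm_num))
    have h1 : ∀ᶠ j : ℕ in Filter.atTop, ∀ x ∈ t, ∀ y ∈ t, x ≠ y → ε / 2 ^ j < |x - y| := by
      rw [Filter.eventually_all_finite htf]
      intro x _
      rw [Filter.eventually_all_finite htf]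
      intro y _
      by_cases hxy : x = y
      · simp [hxy]
      · filter_upwards [hlim.eventually_lt_const (abs_pos.2 (sub_ne_zero.2 hxy))] with j hj _
        exact hj
    have h2 : ∀ᶠ j : ℕ in Filter.atTop, ∀ x ∈ t, ∀ y, |y - x| < ε / 2 ^ j → y ∈ U := by
      rw [Filter.eventually_all_finite htf]
      intro x hx
      obtain ⟨r, hr, hrU⟩ := Metric.isOpen_iff.1 hU x (hts hx).2
      filter_upwards [hlim.eventually_lt_const hr] with j hj y hy
      exact hrU (by rw [Metric.mem_ball, Real.dist_eq]; linarith)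
    obtain ⟨j, hj1, hj2⟩ := (h1.and h2).exists
    have hcell : ∀ x, x ∈ cell (ε / 2 ^ j) ⌊x / (ε / 2 ^ j)⌋ := fun x => (mem_cell_iff (hη j)).2 rfl
    have hclose : ∀ i : ℤ, ∀ x ∈ cell (ε / 2 ^ j) i, ∀ y ∈ cell (ε / 2 ^ j) i,
        |y - x| < ε / 2 ^ j := by
      intro i x hx y hy
      rw [cell, Set.mem_Ico] at hx hy
      rw [abs_lt]; constructor <;> linarith
    refine ⟨j, htf.toFinset.image fun x => ⌊x / (ε / 2 ^ j)⌋, ?_, ?_⟩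
    · rw [Finset.card_image_of_injOn, ← Set.ncard_eq_toFinset_card t htf, Set.ncard, htc]
      · rfl
      · intro x hx y hy hxy
        by_contra hne
        have := hj1 x (by simpa using hx) y (by simpa using hy) hne
        have h3 := hclose _ y (hcell y) x (by simpa only [hxy] using hcell x)
        linarith
    · intro i hi
      obtain ⟨x, hx, rfl⟩ := Finset.mem_image.1 hi
      have hx' : x ∈ t := by simpa using hx
      exact ⟨fun y hy => hj2 x hx' y (hclose _ x (hcell x) y hy),
        occ_eq_true.2 ⟨x, (hts hx').1, hcell x⟩⟩
  · rintro ⟨j, T, rfl, hT⟩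
    choose! p hp using fun i (hi : i ∈ T) => occ_eq_true.1 (hT i hi).2
    have hinj : Set.InjOn p T := by
      intro i hi i' hi' hpp
      rw [← (mem_cell_iff (hη j)).1 (hp i hi).2, ← (mem_cell_iff (hη j)).1 (hp i' hi').2, hpp]
    rw [← Set.encard_coe_eq_coe_finsetCard, ← hinj.encard_image]
    refine Set.encard_le_encard ?_
    rintro _ ⟨i, hi, rfl⟩
    exact ⟨(hp i hi).1, (hT i hi).1 (hp i hi).2⟩

lemma measurable_iSup_gridAlgebra_count_of_isOpen {ε : ℝ} (hε : 0 < ε) {U : Set ℝ}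
    (hU : IsOpen U) : Measurable[⨆ j, gridAlgebra ε j] (count U) := by
  have h : ∀ m : ℕ, MeasurableSet[⨆ j, gridAlgebra ε j] {S | (m : ℕ∞) ≤ count U S} := by
    intro m
    have : {S | (m : ℕ∞) ≤ count U S} = ⋃ (j : ℕ) (T : Finset ℤ) (_ : T.card = m ∧
        ∀ i ∈ T, cell (ε / 2 ^ j) i ⊆ U), ⋂ i ∈ T, {S | occ (ε / 2 ^ j) S i = true} := by
      ext S
      simp only [Set.mem_ofPred_eq, natCast_le_count_iff hε hU, Set.mem_iUnion, Set.mem_iInter,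
        forall_and, exists_prop, and_assoc]
    rw [this]
    refine .iUnion fun j => .iUnion fun T => .iUnion fun _ => ?_
    exact Finset.measurableSet_biInter _ fun i _ => measurableSet_iSup_gridAlgebra_occ hε j i
  refine @ENat.measurable_iff _ (⨆ j, gridAlgebra ε j) _ |>.2 fun m => ?_
  have : count U ⁻¹' {(m : ℕ∞)} =
      {S | (m : ℕ∞) ≤ count U S} \ {S | ((m + 1 : ℕ) : ℕ∞) ≤ count U S} := by
    ext S
    simp only [Set.mem_preimage, Set.mem_singleton_iff, Set.mem_sdiff, Set.mem_ofPred_eq, not_le]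
    rw [Nat.cast_add, Nat.cast_one, ENat.lt_add_one_iff (ENat.natCast_ne_top m)]
    exact ⟨fun h => by simp [h], fun h => le_antisymm h.2 h.1⟩
  rw [this]
  exact (h m).diff (h (m + 1))

lemma measurableSet_carrier (S : LocFinSet) : MeasurableSet S.carrier := by
  have : S.carrier = ⋃ n : ℕ, S.carrier ∩ Set.Icc (-(n : ℝ)) n := by
    rw [← Set.inter_iUnion, Set.iUnion_eq_univ_iff.2, Set.inter_univ]
    intro x
    obtain ⟨n, hn⟩ := exists_nat_ge |x|
    exact ⟨n, abs_le.1 hn⟩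
  rw [this]
  exact .iUnion fun n => (S.finite_inter _ isCompact_Icc).measurableSet

lemma toENNReal_count (S : LocFinSet) {B : Set ℝ} (hB : MeasurableSet B) :
    (S.count B : ENNReal) = Measure.count (S.carrier ∩ B) := by
  rw [Measure.count_apply (S.measurableSet_carrier.inter hB), count]

/-- The occupation bits of the dyadic grids generate the σ-algebra of the space of locally finite
sets. -/
lemma iSup_gridAlgebra {ε : ℝ} (hε : 0 < ε) : ⨆ j, gridAlgebra ε j = instMeasurableSpace := by
  refine le_antisymm (iSup_le fun j => gridAlgebra_le ε j) ?_
  refine iSup₂_le fun B hB => ?_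
  refine Measurable.comap_le ?_
  -- Inside a bounded open interval, the number of points is a finite measure, so its
  -- measurability in `S` passes from open sets to Borel sets.
  let V : ℕ → Set ℝ := fun n => Set.Ioo (-(n : ℝ)) n
  have hV : ∀ n, IsOpen (V n) := fun n => isOpen_Ioo
  let μ : ℕ → LocFinSet → Measure ℝ := fun n S => Measure.count.restrict (S.carrier ∩ V n)
  have hμ : ∀ n S B, MeasurableSet B → μ n S B = (S.count (B ∩ V n) : ENNReal) := by
    intro n S B hB
    rw [toENNReal_count _ (hB.inter (hV n).measurableSet), Measure.restrict_apply hB]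
    congr 1
    ext x; simp only [Set.mem_inter_iff]; tauto
  have hfin : ∀ n S, IsFiniteMeasure (μ n S) := by
    intro n S
    refine ⟨?_⟩
    rw [Measure.restrict_apply .univ, Set.univ_inter, Measure.count_apply
      (S.measurableSet_carrier.inter (hV n).measurableSet)]
    have : (S.carrier ∩ V n).Finite := (S.finite_inter _ isCompact_Icc).subset
      (Set.inter_subset_inter_right _ Set.Ioo_subset_Icc_self)
    simpa using this
  have hop : ∀ n (U : Set ℝ), IsOpen U → Measurable[⨆ j, gridAlgebra ε j] fun S => μ n S U := by
    intro n U hU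
    simp_rw [hμ n _ U hU.measurableSet]
    exact (Measurable.of_discrete (f := fun n : ℕ∞ => (n : ENNReal))).comp
      (measurable_iSup_gridAlgebra_count_of_isOpen hε (hU.inter (hV n)))
  have hmeas : ∀ n, Measurable[⨆ j, gridAlgebra ε j] (μ n) := fun n =>
    @Measurable.measure_of_isPiSystem _ _ (⨆ j, gridAlgebra ε j) _ (μ n) (hfin n) {s | IsOpen s}
      (BorelSpace.measurable_eq) isPiSystem_isOpen
      (fun U hU => hop n U hU) (hop n _ isOpen_univ)
  have hB' : ∀ n, Measurable[⨆ j, gridAlgebra ε j] fun S => (S.count (B ∩ V n) : ENNReal) := by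
    intro n
    simp_rw [← hμ n _ B hB]
    exact (Measure.measurable_coe hB).comp (hmeas n)
  have hsup : ∀ S : LocFinSet, (S.count B : ENNReal) = ⨆ n, (S.count (B ∩ V n) : ENNReal) := by
    intro S
    simp_rw [toENNReal_count _ (hB.inter (hV _).measurableSet), toENNReal_count _ hB]
    have hm : Monotone fun n => S.carrier ∩ (B ∩ V n) := by
      intro n n' hn
      have : (n : ℝ) ≤ n' := by exact_mod_cast hn
      exact Set.inter_subset_inter_right _ (Set.inter_subset_inter_right _
        (Set.Ioo_subset_Ioo (by linarith) this))
    rw [← hm.measure_iUnion, ← Set.inter_iUnion, ← Set.inter_iUnion, Set.iUnion_eq_univ_iff.2,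
      Set.inter_univ]
    intro x
    obtain ⟨n, hn⟩ := exists_nat_gt |x|
    exact ⟨n, abs_lt.1 hn⟩
  have hc : Measurable[⨆ j, gridAlgebra ε j] fun S => (S.count B : ENNReal) := by
    simp_rw [hsup]
    exact @Measurable.iSup _ _ _ _ _ (⨆ j, gridAlgebra ε j) _ _ _ _ _ _ hB'
  refine @ENat.measurable_iff _ (⨆ j, gridAlgebra ε j) _ |>.2 fun m => ?_
  have : count B ⁻¹' {(m : ℕ∞)} = (fun S => (S.count B : ENNReal)) ⁻¹' {(m : ENNReal)} := by
    ext S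
    simp only [Set.mem_preimage, Set.mem_singleton_iff]
    rw [← ENat.toENNReal_coe, ENat.toENNReal_inj]
  rw [this]
  exact hc (measurableSet_singleton _)

end LocFinSet

/-! ### The law of a Poisson process -/

/-- The Bernoulli weights: `r` for `true` and `1 - r` for `false`. -/
noncomputable def bernWeight (r : ℝ) (b : Bool) : ℝ := cond b r (1 - r)

namespace IsPoissonProcess

open LocFinSet

variable {Ω : Type*} [MeasurableSpace Ω] {P : Measure Ω} {X : Ω → LocFinSet} {lam : ℝ≥0}

lemma iIndepFun_count (hX : IsPoissonProcess X lam P) {ι : Type*} [Finite ι] {B : ι → Set ℝ}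
    (hB : ∀ i, MeasurableSet (B i)) (hd : ∀ i j, i ≠ j → Disjoint (B i) (B j)) :
    iIndepFun (fun i ω => (X ω).count (B i)) P := by
  obtain ⟨n, ⟨e⟩⟩ := Finite.exists_equiv_fin ι
  exact iIndepFun.of_precomp e.symm.surjective (hX.indep_count n (fun i => B (e.symm i))
    (fun i => hB _) fun i j hij => hd _ _ (e.symm.injective.ne hij))

lemma measureReal_count_eq_zero (hX : IsPoissonProcess X lam P) {B : Set ℝ}
    (hB : MeasurableSet B) (hB' : volume B ≠ ⊤) :
    P.real {ω | (X ω).count B = 0} = Real.exp (-(lam * (volume B).toReal)) := by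
  rw [(hX.hasLaw_count B hB hB').measureReal_eq (p := fun n => n = 0) (MeasurableSet.of_discrete),
    map_measureReal_apply (Measurable.of_discrete) MeasurableSet.of_discrete]
  have : (Nat.cast : ℕ → ℕ∞) ⁻¹' {n | n = 0} = {0} := by ext; simp
  rw [this, poissonMeasure_real_singleton]
  simp [ENNReal.coe_toNNReal_eq_toReal]

variable [IsProbabilityMeasure P]

lemma measureReal_occ_eq (hX : IsPoissonProcess X lam P) {η : ℝ} (hη : 0 < η) (i : ℤ) (b : Bool) :
    P.real {ω | occ η (X ω) i = b} = bernWeight (1 - Real.exp (-(lam * η))) b := by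
  have hf : P.real {ω | occ η (X ω) i = false} = Real.exp (-(lam * η)) := by
    have := hX.measureReal_count_eq_zero (measurableSet_cell η i) (by simp [volume_cell])
    rw [volume_cell, ENNReal.toReal_ofReal hη.le] at this
    rw [← this]
    simp [occ_eq]
  cases b
  · simp [hf, bernWeight]
  · have : {ω | occ η (X ω) i = true} = {ω | occ η (X ω) i = false}ᶜ := by ext; simp
    rw [this, probReal_compl_eq_one_sub, hf]
    · rfl
    · exact ((measurable_occ η i).comp hX.measurable) (measurableSet_singleton false)

/-- The occupation bits of a Poisson process in finitely many cells of a grid are independent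
Bernoulli variables. -/
lemma measureReal_forall_occ_eq (hX : IsPoissonProcess X lam P) {η : ℝ} (hη : 0 < η) {ι : Type*}
    [Fintype ι] {idx : ι → ℤ} (hidx : Function.Injective idx) (b : ι → Bool) :
    P.real {ω | ∀ i, occ η (X ω) (idx i) = b i} =
      ∏ i, bernWeight (1 - Real.exp (-(lam * η))) (b i) := by
  have hind := hX.iIndepFun_count (B := fun i => cell η (idx i)) (fun i => measurableSet_cell _ _)
    fun i j hij => disjoint_cell hη (hidx.ne hij)
  have h := hind.measure_inter_preimage_eq_mul Finset.univ
    (sets := fun i => {n : ℕ∞ | (!decide (n = 0)) = b i}) fun _ _ => MeasurableSet.of_discrete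
  have hset : {ω | ∀ i, occ η (X ω) (idx i) = b i} = ⋂ i ∈ Finset.univ,
      (fun ω => (X ω).count (cell η (idx i))) ⁻¹' {n : ℕ∞ | (!decide (n = 0)) = b i} := by
    ext ω; simp [occ_eq]
  rw [hset, measureReal_def, h, ENNReal.toReal_prod]
  refine Finset.prod_congr rfl fun i _ => ?_
  rw [← hX.measureReal_occ_eq hη (idx i), measureReal_def]
  simp [occ_eq]

/-- The law of a Poisson process is determined by its intensity. -/
lemma map_eq {Ω' : Type*} [MeasurableSpace Ω'] {P' : Measure Ω'} [IsProbabilityMeasure P']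
    {X' : Ω' → LocFinSet} (hX : IsPoissonProcess X lam P) (hX' : IsPoissonProcess X' lam P') :
    P.map X = P'.map X' := by
  have := Measure.isProbabilityMeasure_map (μ := P) hX.measurable.aemeasurable
  have := Measure.isProbabilityMeasure_map (μ := P') hX'.measurable.aemeasurable
  have hgrid : ∀ j, (P.map X).map (bits 1 j) = (P'.map X').map (bits 1 j) := by
    intro j
    have := Measure.isProbabilityMeasure_map (μ := P.map X) (measurable_bits 1 j).aemeasurable
    have := Measure.isProbabilityMeasure_map (μ := P'.map X') (measurable_bits 1 j).aemeasurable
    have h1 : (0 : ℝ) < 1 / 2 ^ j := by positivity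
    refine Measure.ext_of_measureReal_singleton fun b => ?_
    have e := hX.measureReal_forall_occ_eq h1 (Subtype.val_injective (p := (· ∈ window j))) b
    have e' := hX'.measureReal_forall_occ_eq h1 (Subtype.val_injective (p := (· ∈ window j))) b
    rw [map_measureReal_apply (measurable_bits 1 j) (measurableSet_singleton b),
      map_measureReal_apply (measurable_bits 1 j) (measurableSet_singleton b),
      map_measureReal_apply hX.measurable (measurable_bits 1 j (measurableSet_singleton b)),
      map_measureReal_apply hX'.measurable (measurable_bits 1 j (measurableSet_singleton b))]
    convert e.trans e'.symm using 2 <;>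
    · ext; simp only [Set.mem_preimage, Set.mem_singleton_iff, funext_iff]; rfl
  refine ext_of_generate_finite (⋃ j, {s | MeasurableSet[gridAlgebra 1 j] s}) ?_ ?_ ?_ ?_
  · exact (iSup_gridAlgebra one_pos).symm.trans
      (MeasurableSpace.generateFrom_iUnion_measurableSet (gridAlgebra 1)).symm
  · exact isPiSystem_iUnion_of_monotone _
      (fun j => @MeasurableSpace.isPiSystem_measurableSet _ (gridAlgebra 1 j))
      fun i j hij => gridAlgebra_mono one_pos hij
  · intro s hs
    obtain ⟨j, hj⟩ := Set.mem_iUnion.1 hs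
    obtain ⟨T, rfl⟩ := measurableSet_gridAlgebra.1 hj
    rw [← Measure.map_apply (measurable_bits 1 j) (Set.toFinite T).measurableSet,
      ← Measure.map_apply (measurable_bits 1 j) (Set.toFinite T).measurableSet, hgrid]
  · simp

end IsPoissonProcess

namespace LocFinSet

lemma count_shift (t : ℝ) (S : LocFinSet) (B : Set ℝ) :
    (S.shift t).count B = S.count ((fun x => x + t) ⁻¹' B) := by
  rw [count, count, ← (add_left_injective t).encard_image (S.carrier ∩ _),
    Set.image_inter_preimage]
  rfl

lemma occ_shift (η : ℝ) (k : ℤ) (S : LocFinSet) (i : ℤ) :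
    occ η (S.shift (-(k * η))) i = occ η S (i + k) := by
  rw [occ_eq, occ_eq, count_shift]
  have : (fun x : ℝ => x + -(k * η)) ⁻¹' cell η i = cell η (i + k) := ?_
  · rw [this]
  ext x
  simp only [cell, Set.mem_preimage, Set.mem_Ico]
  push_cast
  constructor <;> rintro ⟨h1, h2⟩ <;> constructor <;> linarith

lemma measurable_shift (t : ℝ) : Measurable (shift t) := by
  refine measurable_of_count fun B hB => ?_
  simp_rw [count_shift]
  exact measurable_count (measurable_add_const t hB)

lemma occ_union (η : ℝ) (S T : LocFinSet) (i : ℤ) :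
    occ η (S ∪ T) i = (occ η S i || occ η T i) := by
  rw [Bool.eq_iff_iff, Bool.or_eq_true, occ_eq_true, occ_eq_true, occ_eq_true,
    ← Set.union_nonempty, ← Set.union_inter_distrib_right]
  rfl

lemma shift_union (t : ℝ) (S T : LocFinSet) : (S ∪ T).shift t = S.shift t ∪ T.shift t := by
  change (LocFinSet.mk _ _) = LocFinSet.mk _ _
  simp only [LocFinSet.mk.injEq]
  exact Set.image_union ..

end LocFinSet

lemma IsPoissonProcess.shift {Ω : Type*} [MeasurableSpace Ω] {P : Measure Ω} {X : Ω → LocFinSet}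
    {lam : ℝ≥0} (hX : IsPoissonProcess X lam P) (t : ℝ) :
    IsPoissonProcess (fun ω => (X ω).shift t) lam P where
  measurable := (LocFinSet.measurable_shift t).comp hX.measurable
  hasLaw_count B hB hB' := by
    simp_rw [LocFinSet.count_shift]
    have h : volume ((fun x => x + t) ⁻¹' B) = volume B := measure_preimage_add_right volume t B
    rw [← h] at hB' ⊢
    exact hX.hasLaw_count _ (measurable_add_const t hB) hB'
  indep_count n B hB hd := by
    simp_rw [LocFinSet.count_shift]
    exact hX.indep_count n _ (fun i => measurable_add_const t (hB i))
      fun i j hij => (hd i j hij).preimage _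

/-! ### Finite predictors -/

namespace LocFinSet

/-- An event on the space of locally finite sets is, up to an error of small probability,
determined by the occupation bits of all sufficiently fine grids. -/
lemma exists_bits_approx {ε : ℝ} (hε : 0 < ε) (μ : Measure LocFinSet) [IsProbabilityMeasure μ]
    {E : Set LocFinSet} (hE : MeasurableSet E) {δ : ℝ} (hδ : 0 < δ) :
    ∃ j₀, ∀ j ≥ j₀, ∃ T : Set (window j → Bool), μ.real (symmDiff E (bits ε j ⁻¹' T)) < δ := by
  have hgen : instMeasurableSpace =
      MeasurableSpace.generateFrom (⋃ j, {s | MeasurableSet[gridAlgebra ε j] s}) :=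
    (iSup_gridAlgebra hε).symm.trans
      (MeasurableSpace.generateFrom_iUnion_measurableSet (gridAlgebra ε)).symm
  have halg : IsSetAlgebra (⋃ j, {s | MeasurableSet[gridAlgebra ε j] s}) := by
    refine ⟨?_, ?_, ?_⟩
    · exact Set.mem_iUnion.2 ⟨0, @MeasurableSet.empty _ (gridAlgebra ε 0)⟩
    · intro s hs
      obtain ⟨j, hj⟩ := Set.mem_iUnion.1 hs
      exact Set.mem_iUnion.2 ⟨j, @MeasurableSet.compl _ s (gridAlgebra ε j) hj⟩
    · intro s t hs ht
      obtain ⟨j, hj⟩ := Set.mem_iUnion.1 hs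
      obtain ⟨k, hk⟩ := Set.mem_iUnion.1 ht
      exact Set.mem_iUnion.2 ⟨max j k, @MeasurableSet.union _ (gridAlgebra ε (max j k)) s t
        (gridAlgebra_mono hε (le_max_left j k) _ hj) (gridAlgebra_mono hε (le_max_right j k) _ hk)⟩
  obtain ⟨t, ht, hμ⟩ := (Measure.MeasureDense.of_generateFrom_isSetAlgebra_finite μ halg hgen).approx
    E hE (measure_ne_top _ _) δ hδ
  obtain ⟨j₀, hj₀⟩ := Set.mem_iUnion.1 ht
  refine ⟨j₀, fun j hj => ?_⟩
  obtain ⟨T, hT⟩ := measurableSet_gridAlgebra.1 (gridAlgebra_mono hε hj _ hj₀)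
  refine ⟨T, ?_⟩
  rw [hT, measureReal_def]
  exact ENNReal.toReal_lt_of_lt_ofReal hμ

end LocFinSet

/-! ### Poisson many independent points -/

section PoissonSample

variable {E : Type*} [MeasurableSpace E]

open Classical in
/-- For a sample `(N, (u₀, u₁, …))`, the number of the points `u₀, …, u_{N-1}` that lie in `B`. -/
noncomputable def sampleCount (B : Set E) (ω : ℕ × (ℕ → E)) : ℕ :=
  ((Finset.range ω.1).filter fun j => ω.2 j ∈ B).card

/-- The law of a Poisson number and, independently, a sequence of independent points of law `ν`. -/
noncomputable def sampleMeasure (ν : Measure E) (lam : ℝ≥0) : Measure (ℕ × (ℕ → E)) :=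
  (poissonMeasure lam).prod (Measure.infinitePi fun _ => ν)

instance (ν : Measure E) [IsProbabilityMeasure ν] (lam : ℝ≥0) :
    IsProbabilityMeasure (sampleMeasure ν lam) := by
  unfold sampleMeasure; infer_instance

lemma measurable_sampleCount {B : Set E} (hB : MeasurableSet B) : Measurable (sampleCount B) := by
  classical
  refine measurable_from_prod_countable_right fun n => ?_
  simp only [sampleCount, Finset.card_filter]
  exact Finset.measurable_fun_sum _ fun j _ =>
    Measurable.ite (measurable_pi_apply j hB) measurable_const measurable_const

lemma integral_infinitePi_prod_range (ν : Measure E) [IsProbabilityMeasure ν] {ψ : E → ℂ}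
    (hψ : Measurable ψ) (n : ℕ) :
    ∫ u : ℕ → E, ∏ j ∈ Finset.range n, ψ (u j) ∂(Measure.infinitePi fun _ => ν)
      = (∫ x, ψ x ∂ν) ^ n := by
  have hind : iIndepFun (fun (j : Fin n) (u : ℕ → E) => u j) (Measure.infinitePi fun _ => ν) :=
    (iIndepFun_infinitePi (P := fun _ : ℕ => ν) (X := fun _ x => x)
      fun _ => measurable_id).precomp Fin.val_injective
  have h := hind.integral_fun_prod_comp (f := fun _ => ψ)
    (fun i => (measurable_pi_apply _).aemeasurable) fun i => hψ.aestronglyMeasurable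
  simp_rw [Finset.prod_range]
  rw [h, Finset.prod_congr rfl (g := fun _ => ∫ x, ψ x ∂ν), Finset.prod_const, Finset.card_univ,
    Fintype.card_fin]
  intro i _
  have := integral_map (μ := Measure.infinitePi fun _ : ℕ => ν)
    (measurable_pi_apply (i : ℕ)).aemeasurable (f := ψ) hψ.aestronglyMeasurable
  rw [← this, Measure.infinitePi_map_eval]

/-- The joint characteristic function of the numbers of points in disjoint sets. -/
lemma integral_exp_sampleCount (ν : Measure E) [IsProbabilityMeasure ν] (lam : ℝ≥0) {ι : Type*}
    [Fintype ι] {B : ι → Set E} (hB : ∀ i, MeasurableSet (B i))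
    (hd : ∀ i j, i ≠ j → Disjoint (B i) (B j)) (t : ι → ℝ) :
    ∫ ω, Complex.exp ((∑ i, (t i : ℂ) * sampleCount (B i) ω) * Complex.I) ∂(sampleMeasure ν lam) =
      ∏ i, Complex.exp (lam * ν.real (B i) * (Complex.exp (t i * Complex.I) - 1)) := by
  classical
  let ψ : E → ℂ := fun x => ∏ i, if x ∈ B i then Complex.exp (t i * Complex.I) else 1
  have hψ : Measurable ψ := Finset.measurable_fun_prod _ fun i _ =>
    Measurable.ite (hB i) measurable_const measurable_const
  have hψn : ∀ x, ‖ψ x‖ = 1 := by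
    intro x
    simp only [ψ, norm_prod]
    refine Finset.prod_eq_one fun i _ => ?_
    split_ifs
    · exact Complex.norm_exp_ofReal_mul_I _
    · simp
  have hexp : ∀ ω : ℕ × (ℕ → E), Complex.exp ((∑ i, (t i : ℂ) * sampleCount (B i) ω) * Complex.I) =
      ∏ j ∈ Finset.range ω.1, ψ (ω.2 j) := by
    intro ω
    rw [Finset.sum_mul, Complex.exp_sum, Finset.prod_comm]
    refine Finset.prod_congr rfl fun i _ => ?_
    rw [Finset.prod_ite, Finset.prod_const, Finset.prod_const_one, mul_one, ← Complex.exp_nat_mul]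
    congr 1
    simp only [sampleCount]
    ring
  -- As the sets are disjoint, at most one factor of `ψ x` differs from `1`.
  have hψ1 : ∀ x, ψ x - 1 = ∑ i, (B i).indicator (fun _ => Complex.exp (t i * Complex.I) - 1) x := by
    intro x
    by_cases hx : ∃ i, x ∈ B i
    · obtain ⟨i, hi⟩ := hx
      have hne : ∀ k, k ≠ i → x ∉ B k := fun k hk hxk =>
        Set.disjoint_left.1 (hd k i hk) hxk hi
      simp only [ψ]
      rw [Finset.prod_eq_single i, Finset.sum_eq_single i]
      · simp [hi]
      · intro k _ hk; simp [hne k hk]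
      · simp
      · intro k _ hk; simp [hne k hk]
      · simp
    · push Not at hx
      simp [ψ, hx]
  have hint : ∫ x, ψ x ∂ν = 1 + ∑ i, (ν.real (B i) : ℂ) * (Complex.exp (t i * Complex.I) - 1) := by
    have h1 : ∀ x, ψ x = 1 + ∑ i, (B i).indicator (fun _ => Complex.exp (t i * Complex.I) - 1) x :=
      fun x => by rw [← hψ1]; ring
    have hi : ∀ i ∈ Finset.univ, Integrable
        (fun x => (B i).indicator (fun _ => Complex.exp (t i * Complex.I) - 1) x) ν :=
      fun i _ => (integrable_const _).indicator (hB i)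
    simp_rw [h1]
    rw [integral_add (integrable_const _) (integrable_finsetSum _ hi), integral_finsetSum _ hi]
    congr 1
    · simp
    · refine Finset.sum_congr rfl fun i _ => ?_
      rw [integral_indicator_const _ (hB i), Complex.real_smul]
  have hmeas : Measurable fun ω : ℕ × (ℕ → E) => ∏ j ∈ Finset.range ω.1, ψ (ω.2 j) :=
    measurable_from_prod_countable_right fun n =>
      Finset.measurable_fun_prod (f := fun j (u : ℕ → E) => ψ (u j)) (Finset.range n)
        fun j _ => hψ.comp (measurable_pi_apply j)
  have hnorm : ∀ ω : ℕ × (ℕ → E), ‖∏ j ∈ Finset.range ω.1, ψ (ω.2 j)‖ ≤ 1 := fun ω => by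
    simp [norm_prod, hψn]
  have hz : ‖∫ x, ψ x ∂ν‖ ≤ 1 := by
    refine (norm_integral_le_integral_norm _).trans ?_
    simp [hψn]
  simp_rw [hexp]
  unfold sampleMeasure
  rw [integral_prod _ (Integrable.of_bound hmeas.aestronglyMeasurable 1 (.of_forall hnorm))]
  simp_rw [integral_infinitePi_prod_range ν hψ]
  rw [integral_poissonMeasure' (Integrable.of_bound
    (Measurable.of_discrete.aestronglyMeasurable) 1 (.of_forall fun n => by
      rw [norm_pow]; exact pow_le_one₀ (norm_nonneg _) hz)), ← Complex.exp_sum]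
  have hs : ∀ z : ℂ, ∑' n : ℕ, (Real.exp (-lam) * (lam : ℝ) ^ n / (n.factorial : ℝ)) • z ^ n =
      Complex.exp (lam * (z - 1)) := by
    intro z
    have h2 := (NormedSpace.expSeries_div_hasSum_exp ((lam : ℂ) * z)).mul_left (Complex.exp (-lam))
    rw [← Complex.exp_eq_exp_ℂ, ← Complex.exp_add] at h2
    rw [show (lam : ℂ) * (z - 1) = -lam + lam * z by ring, ← h2.tsum_eq]
    refine tsum_congr fun n => ?_
    rw [Complex.real_smul]
    push_cast
    rw [mul_pow]
    ring
  rw [hs, hint]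
  congr 1
  rw [add_sub_cancel_left, Finset.mul_sum]
  exact Finset.sum_congr rfl fun i _ => by ring

lemma hasLaw_sampleCount (ν : Measure E) [IsProbabilityMeasure ν] (lam : ℝ≥0) {B : Set E}
    (hB : MeasurableSet B) :
    HasLaw (sampleCount B) (poissonMeasure (lam * (ν B).toNNReal)) (sampleMeasure ν lam) := by
  refine ⟨(measurable_sampleCount hB).aemeasurable, ?_⟩
  have hemb : MeasurableEmbedding (Nat.cast : ℕ → ℝ) := .natCast
  have := Measure.isProbabilityMeasure_map (μ := sampleMeasure ν lam)
    (measurable_sampleCount hB).aemeasurable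
  have := Measure.isProbabilityMeasure_map (μ := (sampleMeasure ν lam).map (sampleCount B))
    hemb.measurable.aemeasurable
  refine hemb.map_injective (Measure.ext_of_charFun ?_)
  ext t
  rw [charFun_map_cast_poissonMeasure, Measure.map_map hemb.measurable (measurable_sampleCount hB),
    charFun_apply_real, integral_map (hemb.measurable.comp (measurable_sampleCount hB)).aemeasurable
      (Measurable.aestronglyMeasurable (by fun_prop))]
  have h := integral_exp_sampleCount ν lam (ι := Unit) (B := fun _ => B) (fun _ => hB)
    (fun i j hij => (hij rfl).elim) (fun _ => t)
  simp only [Finset.univ_unique, Finset.sum_singleton, Finset.prod_singleton] at h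
  simp only [Function.comp_apply, Complex.ofReal_natCast]
  rw [h]
  congr 2
  rw [measureReal_def]
  push_cast
  rfl

lemma iIndepFun_sampleCount (ν : Measure E) [IsProbabilityMeasure ν] (lam : ℝ≥0) {ι : Type*}
    [Fintype ι] {B : ι → Set E} (hB : ∀ i, MeasurableSet (B i))
    (hd : ∀ i j, i ≠ j → Disjoint (B i) (B j)) :
    iIndepFun (fun i => sampleCount (B i)) (sampleMeasure ν lam) := by
  have hm : ∀ i, Measurable fun ω => (sampleCount (B i) ω : ℝ) := fun i =>
    Measurable.of_discrete.comp (measurable_sampleCount (hB i))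
  have hR : iIndepFun (fun i ω => (sampleCount (B i) ω : ℝ)) (sampleMeasure ν lam) := by
    rw [iIndepFun_iff_charFun_pi fun i => (hm i).aemeasurable]
    intro t
    have hm2 : Measurable fun ω => WithLp.toLp 2 fun i => (sampleCount (B i) ω : ℝ) :=
      (PiLp.continuous_toLp 2 _).measurable.comp (measurable_pi_lambda _ hm)
    rw [charFun_apply, integral_map hm2.aemeasurable
      (Continuous.aestronglyMeasurable (by fun_prop))]
    have h1 := integral_exp_sampleCount ν lam hB hd t
    have h2 : ∀ ω, ((inner ℝ (WithLp.toLp 2 fun i => (sampleCount (B i) ω : ℝ)) t : ℝ) : ℂ) =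
        ∑ i, (t i : ℂ) * sampleCount (B i) ω := by
      intro ω
      simp [PiLp.inner_apply]
    simp_rw [h2]
    rw [h1]
    refine Finset.prod_congr rfl fun i _ => ?_
    rw [charFun_apply_real, integral_map (hm i).aemeasurable
      (Continuous.aestronglyMeasurable (by fun_prop))]
    have h := integral_exp_sampleCount ν lam (ι := Unit) (B := fun _ => B i) (fun _ => hB i)
      (fun i j hij => (hij rfl).elim) (fun _ => t i)
    simp only [Finset.univ_unique, Finset.sum_singleton, Finset.prod_singleton] at h
    simp only [Complex.ofReal_natCast]
    rw [h]
  have := hR.comp (fun _ x => ⌊x⌋₊) fun _ => Nat.measurable_floor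
  simpa [Function.comp_def] using this

end PoissonSample

/-! ### Existence of the Poisson process -/

instance : BorelSpace ℕ∞ where
  measurable_eq := by
    refine le_antisymm (fun s _ => ?_) le_top
    borelize ℕ∞
    exact (Set.to_countable s).measurableSet

/-- Grouping an independent family by the first index. -/
lemma iIndepFun_group {Ω ι κ 𝓧 : Type*} [MeasurableSpace Ω] [MeasurableSpace 𝓧] {P : Measure Ω}
    [IsProbabilityMeasure P] {X : ι → κ → Ω → 𝓧} (hm : ∀ i j, Measurable (X i j))
    (h : iIndepFun (fun (p : ι × κ) => X p.1 p.2) P) :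
    iIndepFun (fun i ω j => X i j ω) P := by
  have := fun i j => Measure.isProbabilityMeasure_map (μ := P) (hm i j).aemeasurable
  rw [iIndepFun_iff_map_fun_eq_infinitePi_map fun i => measurable_pi_lambda _ (hm i)]
  have h1 : ∀ i, P.map (fun ω j => X i j ω) = Measure.infinitePi fun j => P.map (X i j) := fun i =>
    (h.precomp (Prod.mk_right_injective i)).map_fun_eq_infinitePi_map (hm i)
  simp_rw [h1]
  have h2 := h.map_fun_eq_infinitePi_map fun p : ι × κ => hm p.1 p.2
  rw [← Measure.infinitePi_map_curry fun i j => P.map (X i j), ← h2,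
    Measure.map_map (MeasurableEquiv.measurable _) (measurable_pi_lambda _ fun p : ι × κ => hm p.1 p.2)]
  rfl

lemma iIndepFun_comp_measurePreserving {Ω Ω' ι 𝓧 : Type*} [MeasurableSpace Ω] [MeasurableSpace Ω']
    [MeasurableSpace 𝓧] {P : Measure Ω} {P' : Measure Ω'} {g : Ω' → Ω}
    (hg : MeasurePreserving g P' P) {X : ι → Ω → 𝓧} (hm : ∀ i, Measurable (X i))
    (h : iIndepFun X P) : iIndepFun (fun i => X i ∘ g) P' := by
  rw [iIndepFun_iff_measure_inter_preimage_eq_mul] at h ⊢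
  intro S s hs
  have := h S hs
  rw [← hg.measure_preimage (Finset.measurableSet_biInter _ fun i hi =>
    hm i (hs i hi)).nullMeasurableSet] at this
  rw [Set.preimage_iInter₂] at this
  simp_rw [Set.preimage_comp]
  rw [this]
  exact Finset.prod_congr rfl fun i hi =>
    (hg.measure_preimage (hm i (hs i hi)).nullMeasurableSet).symm

lemma hasLaw_finset_sum_poissonMeasure {Ω ι : Type*} [MeasurableSpace Ω] {P : Measure Ω}
    [IsProbabilityMeasure P] {X : ι → Ω → ℕ} (hm : ∀ i, Measurable (X i)) (h : iIndepFun X P)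
    {r : ι → ℝ≥0} (hr : ∀ i, HasLaw (X i) (poissonMeasure (r i)) P) (s : Finset ι) :
    HasLaw (∑ i ∈ s, X i) (poissonMeasure (∑ i ∈ s, r i)) P := by
  classical
  induction s using Finset.induction_on with
  | empty =>
    refine ⟨measurable_const.aemeasurable, ?_⟩
    have h0 : poissonMeasure 0 {0} = 1 := by simp [poissonMeasure_singleton]
    have h1 : (∑ i ∈ (∅ : Finset ι), X i) = fun _ => 0 := by ext; simp
    rw [h1, Finset.sum_empty, Measure.map_const, measure_univ, one_smul]
    refine Measure.ext_of_singleton fun n => ?_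
    rw [poissonMeasure_singleton]
    rcases eq_or_ne n 0 with rfl | hn
    · simp
    · simp [hn, hn.symm]
  | insert i s hi ih =>
    rw [Finset.sum_insert hi, Finset.sum_insert hi, add_comm, add_comm (r i)]
    exact (h.indepFun_finsetSum_of_notMem hm hi).hasLaw_add_poissonMeasure ih (hr i)

/-- The sum of a family of natural numbers indexed by `ℤ`, in `ℕ∞`. -/
noncomputable def totalCount (g : ℤ → ℕ) : ℕ∞ :=
  ⨆ K : ℕ, ((∑ k ∈ Finset.Icc (-K : ℤ) K, g k : ℕ) : ℕ∞)

lemma monotone_sum_Icc (g : ℤ → ℕ) :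
    Monotone fun K : ℕ => ∑ k ∈ Finset.Icc (-K : ℤ) K, g k := by
  intro K K' h
  exact Finset.sum_le_sum_of_subset (Finset.Icc_subset_Icc (by simpa using h) (by simpa using h))

lemma measurable_totalCount : Measurable totalCount := by
  refine Measurable.iSup fun K => ?_
  exact Measurable.of_discrete.comp (Finset.measurable_fun_sum _ fun k _ => measurable_pi_apply k)

lemma poissonMeasure_Iic (r : ℝ≥0) (c : ℕ) : poissonMeasure r (Set.Iic c) =
    ∑ n ∈ Finset.Iic c, ENNReal.ofReal (Real.exp (-r) * r ^ n / n.factorial) := by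
  simp_rw [← poissonMeasure_singleton]
  rw [sum_measure_singleton, Finset.coe_Iic]

/-- A sum of infinitely many independent Poisson variables with summable means is Poisson. -/
lemma hasLaw_totalCount {Ω : Type*} [MeasurableSpace Ω] {P : Measure Ω} [IsProbabilityMeasure P]
    {X : ℤ → Ω → ℕ} (hm : ∀ i, Measurable (X i)) (h : iIndepFun X P) {r : ℤ → ℝ≥0} {a : ℝ≥0}
    (hr : ∀ i, HasLaw (X i) (poissonMeasure (r i)) P) (ha : HasSum r a) :
    HasLaw (fun ω => totalCount fun k => X k ω)
      ((poissonMeasure a).map (Nat.cast : ℕ → ℕ∞)) P := by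
  have hmeas : Measurable fun ω => totalCount fun k => X k ω :=
    measurable_totalCount.comp (measurable_pi_lambda _ hm)
  refine ⟨hmeas.aemeasurable, ?_⟩
  have := Measure.isProbabilityMeasure_map (μ := P) hmeas.aemeasurable
  have := Measure.isProbabilityMeasure_map (μ := poissonMeasure a)
    (Measurable.of_discrete (f := (Nat.cast : ℕ → ℕ∞))).aemeasurable
  refine Measure.ext_of_Iic _ _ fun c => ?_
  induction c using ENat.recTopCoe with
  | top => rw [Set.Iic_top, measure_univ, measure_univ]
  | coe c =>
    rw [Measure.map_apply hmeas .of_discrete, Measure.map_apply .of_discrete .of_discrete]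
    have h1 : (fun ω => totalCount fun k => X k ω) ⁻¹' Set.Iic (c : ℕ∞) =
        ⋂ K : ℕ, (∑ k ∈ Finset.Icc (-K : ℤ) K, X k) ⁻¹' Set.Iic c := by
      ext ω
      simp only [totalCount, Set.mem_preimage, Set.mem_Iic, iSup_le_iff, Nat.cast_le,
        Set.mem_iInter, Finset.sum_apply]
    have h2 : (Nat.cast : ℕ → ℕ∞) ⁻¹' Set.Iic (c : ℕ∞) = Set.Iic c := by ext; simp
    rw [h1, h2]
    have hs : ∀ K : ℕ, Measurable (∑ k ∈ Finset.Icc (-K : ℤ) K, X k) := fun K =>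
      by
      simp_rw [Finset.sum_fn]
      exact Finset.measurable_fun_sum _ fun k _ => hm k
    have hlim := tendsto_measure_iInter_atTop (μ := P)
      (s := fun K : ℕ => (∑ k ∈ Finset.Icc (-K : ℤ) K, X k) ⁻¹' Set.Iic c)
      (fun K => (hs K .of_discrete).nullMeasurableSet)
      (fun K K' hK ω hω => by
        simp only [Set.mem_preimage, Set.mem_Iic, Finset.sum_apply] at hω ⊢
        exact (monotone_sum_Icc (fun k => X k ω) hK).trans hω) ⟨0, measure_ne_top _ _⟩
    refine tendsto_nhds_unique hlim ?_
    have hval : ∀ K : ℕ, P ((∑ k ∈ Finset.Icc (-K : ℤ) K, X k) ⁻¹' Set.Iic c) =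
        poissonMeasure (∑ k ∈ Finset.Icc (-K : ℤ) K, r k) (Set.Iic c) := fun K => by
      rw [← (hasLaw_finset_sum_poissonMeasure hm h hr _).map_eq,
        Measure.map_apply (hs K) .of_discrete]
    have hra := ha.comp Finset.tendsto_Icc_neg
    simp only [Function.comp_def, hval, poissonMeasure_Iic]
    refine tendsto_finsetSum _ fun n _ => ENNReal.tendsto_ofReal ?_
    have hc : Continuous fun x : ℝ≥0 => Real.exp (-x) * (x : ℝ) ^ n / n.factorial := by fun_prop
    exact (hc.tendsto a).comp hra

namespace PoissonConstruction

/-- Samples of points in each of the intervals `[k, k + 1)`, `k ∈ ℤ`. -/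
abbrev Sample : Type := ℤ → ℕ × (ℕ → ℝ)

/-- The uniform distribution on `[k, k + 1)`. -/
noncomputable def unif (k : ℤ) : Measure ℝ := volume.restrict (Set.Ico k (k + 1))

instance (k : ℤ) : IsProbabilityMeasure (unif k) := ⟨by simp [unif]⟩

instance (k : ℤ) : NullSingletonClass (unif k) := by unfold unif; infer_instance

/-- Independently for all `k`, a Poisson number of independent uniform points of `[k, k + 1)`. -/
noncomputable def sampleLaw (lam : ℝ≥0) : Measure Sample :=
  Measure.infinitePi fun k => sampleMeasure (unif k) lam

instance (lam : ℝ≥0) : IsProbabilityMeasure (sampleLaw lam) := by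
  unfold sampleLaw; infer_instance

/-- The almost sure event that all points lie in their intervals and are pairwise distinct. -/
def good : Set Sample :=
  {ω | (∀ (k : ℤ) (i : ℕ), (ω k).2 i ∈ Set.Ico (k : ℝ) (k + 1)) ∧ ∀ k i j, i ≠ j → (ω k).2 i ≠ (ω k).2 j}

lemma measurable_point (k : ℤ) (i : ℕ) : Measurable fun ω : Sample => (ω k).2 i := by fun_prop

lemma measurableSet_good : MeasurableSet good := by
  have : good = (⋂ (k : ℤ) (i : ℕ), (fun ω : Sample => (ω k).2 i) ⁻¹' Set.Ico (k : ℝ) (k + 1)) ∩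
      ⋂ (k : ℤ) (i : ℕ) (j : ℕ) (_ : i ≠ j), {ω : Sample | (ω k).2 i = (ω k).2 j}ᶜ := by
    ext ω; simp [good]
  rw [this]
  refine .inter (.iInter fun k => .iInter fun i => measurable_point k i measurableSet_Ico) ?_
  exact .iInter fun k => .iInter fun i => .iInter fun j => .iInter fun _ =>
    (measurableSet_eq_fun (measurable_point k i) (measurable_point k j)).compl

lemma ae_mem_good (lam : ℝ≥0) : ∀ᵐ ω ∂(sampleLaw lam), ω ∈ good := by
  have hk : ∀ k, MeasurePreserving (fun ω : Sample => (ω k).2) (sampleLaw lam)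
      (Measure.infinitePi fun _ => unif k) := fun k =>
    (measurePreserving_snd (μ := poissonMeasure lam)).comp
      (measurePreserving_eval_infinitePi (fun k => sampleMeasure (unif k) lam) k)
  refine Filter.Eventually.and ?_ ?_
  · rw [ae_all_iff]; intro k
    rw [ae_all_iff]; intro i
    have h := (measurePreserving_eval_infinitePi (fun _ : ℕ => unif k) i).comp (hk k)
    refine h.quasiMeasurePreserving.ae (p := fun x => x ∈ Set.Ico (k : ℝ) (k + 1)) ?_
    exact ae_restrict_mem measurableSet_Ico
  · rw [ae_all_iff]; intro k
    rw [ae_all_iff]; intro i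
    rw [ae_all_iff]; intro j
    by_cases hij : i = j
    · simp [hij]
    have h2 : MeasurePreserving (fun u : ℕ → ℝ => (u i, u j)) (Measure.infinitePi fun _ => unif k)
        ((unif k).prod (unif k)) := ⟨by fun_prop, Measure.infinitePi_map_eval_prod hij⟩
    have h3 : ∀ᵐ p ∂((unif k).prod (unif k)), p.1 ≠ p.2 := by
      rw [Measure.ae_prod_iff_ae_ae (p := fun p : ℝ × ℝ => p.1 ≠ p.2)
        (measurableSet_eq_fun measurable_fst measurable_snd).compl]
      refine .of_forall fun x => ?_
      have : ∀ᵐ y ∂(unif k), y ≠ x := by simp [ae_iff]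
      filter_upwards [this] with y hy using hy.symm
    filter_upwards [(h2.comp (hk k)).quasiMeasurePreserving.ae h3] with ω hω _ using hω

/-- The union of the samples in all intervals `[k, k + 1)`; empty outside the event `good`. -/
noncomputable def process (ω : Sample) : LocFinSet where
  carrier := {x | ω ∈ good ∧ ∃ (k : ℤ) (i : ℕ), i < (ω k).1 ∧ (ω k).2 i = x}
  finite_inter K hK := by
    obtain ⟨R, hR⟩ := hK.isBounded.subset_closedBall 0
    by_cases hω : ω ∈ good
    swap
    · simp [hω]
    have hfin : (⋃ k ∈ Set.Icc ⌊-R⌋ ⌊R⌋, (fun i => (ω k).2 i) '' Set.Iio (ω k).1).Finite :=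
      (Set.finite_Icc _ _).biUnion fun k _ => (Set.finite_Iio _).image _
    refine hfin.subset ?_
    rintro _ ⟨⟨-, k, i, hi, rfl⟩, hx⟩
    have hk := hω.1 k i
    have hx' := hR hx
    rw [Metric.mem_closedBall, dist_zero_right, Real.norm_eq_abs, abs_le] at hx'
    refine Set.mem_biUnion (x := k) ⟨?_, ?_⟩ ⟨i, hi, rfl⟩
    · have : ((⌊-R⌋ : ℤ) : ℝ) < ((k + 1 : ℤ) : ℝ) := by
        push_cast; linarith [Int.floor_le (-R), hk.2]
      have := Int.cast_lt.1 this
      omega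
    · exact Int.le_floor.2 (hk.1.trans hx'.2)

lemma count_process {ω : Sample} (hω : ω ∈ good) (B : Set ℝ) :
    (process ω).count B = totalCount fun k => sampleCount B (ω k) := by
  classical
  let J : ℤ → Finset ℕ := fun k => (Finset.range (ω k).1).filter fun i => (ω k).2 i ∈ B
  let pt : (Σ _ : ℤ, ℕ) → ℝ := fun p => (ω p.1).2 p.2
  have hinj : Function.Injective pt := by
    rintro ⟨k, i⟩ ⟨l, j⟩ h
    have hkl : k = l := by
      rw [← Int.floor_eq_iff.2 (hω.1 k i), ← Int.floor_eq_iff.2 (hω.1 l j)]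
      exact congrArg Int.floor h
    subst hkl
    by_contra hne
    exact hω.2 k i j (fun h' => hne (by rw [h'])) h
  have hset : (process ω).carrier ∩ B = pt '' {p | p.2 ∈ J p.1} := by
    ext x
    constructor
    · rintro ⟨⟨-, k, i, hi, rfl⟩, hx⟩
      exact ⟨⟨k, i⟩, by simp [J, hi, hx], rfl⟩
    · rintro ⟨⟨k, i⟩, hp, rfl⟩
      simp only [J, Set.mem_ofPred_eq, Finset.mem_filter, Finset.mem_range] at hp
      exact ⟨⟨hω, k, i, hp.1, rfl⟩, hp.2⟩
  have hsum : ∀ s : Finset ℤ, ((∑ k ∈ s, sampleCount B (ω k) : ℕ) : ℕ∞) =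
      ((s.sigma J : Finset (Σ _ : ℤ, ℕ)) : Set (Σ _ : ℤ, ℕ)).encard := by
    intro s
    rw [Set.encard_coe_eq_coe_finsetCard, Finset.card_sigma]
    rfl
  rw [LocFinSet.count, hset, hinj.encard_image, totalCount]
  refine le_antisymm ?_ ?_
  · refine ENat.forall_natCast_le_iff_le.1 fun n hn => ?_
    obtain ⟨t, hts, htc⟩ := Set.exists_subset_encard_eq hn
    have htf : t.Finite := Set.finite_of_encard_eq_coe htc
    obtain ⟨K, hK⟩ : ∃ K : ℕ, htf.toFinset.image Sigma.fst ⊆ Finset.Icc (-K : ℤ) K :=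
      ((Finset.tendsto_Icc_neg (R := ℤ)).eventually_ge_atTop _).exists
    refine le_trans ?_ (le_iSup _ K)
    rw [hsum, ← htc]
    refine Set.encard_le_encard fun p hp => ?_
    rw [Finset.mem_coe, Finset.mem_sigma]
    exact ⟨hK (Finset.mem_image_of_mem _ (by simpa using hp)), hts hp⟩
  · refine iSup_le fun K => ?_
    rw [hsum]
    exact Set.encard_le_encard fun p hp => (Finset.mem_sigma.1 (Finset.mem_coe.1 hp)).2

lemma measurable_process : Measurable process := by
  classical
  refine LocFinSet.measurable_of_count fun B hB => ?_
  have : (fun ω => (process ω).count B) = fun ω => if ω ∈ good then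
      totalCount (fun k => sampleCount B (ω k)) else 0 := by
    ext1 ω
    split_ifs with hω
    · exact count_process hω B
    · rw [LocFinSet.count_eq_zero]
      simp [process, hω]
  rw [this]
  refine Measurable.ite measurableSet_good ?_ measurable_const
  exact measurable_totalCount.comp
    (measurable_pi_lambda _ fun k => (measurable_sampleCount hB).comp (measurable_pi_apply k))

lemma isPoissonProcess_process (lam : ℝ≥0) : IsPoissonProcess process lam (sampleLaw lam) where
  measurable := measurable_process
  hasLaw_count B hB hB' := by
    have hm : ∀ k : ℤ, Measurable fun ω : Sample => sampleCount B (ω k) := fun k =>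
      (measurable_sampleCount hB).comp (measurable_pi_apply k)
    have hlaw : ∀ k : ℤ, HasLaw (fun ω : Sample => sampleCount B (ω k))
        (poissonMeasure (lam * (unif k B).toNNReal)) (sampleLaw lam) := fun k =>
      (hasLaw_sampleCount (unif k) lam hB).comp
        (measurePreserving_eval_infinitePi (fun k => sampleMeasure (unif k) lam) k).hasLaw
    have hind : iIndepFun (fun k (ω : Sample) => sampleCount B (ω k)) (sampleLaw lam) :=
      iIndepFun_infinitePi (X := fun _ => sampleCount B) fun k => measurable_sampleCount hB
    have hsum : ∑' k, unif k B = volume B := by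
      have h := measure_iUnion (μ := volume) (f := fun k : ℤ => B ∩ Set.Ico (k : ℝ) (k + 1))
        (fun i j hij => ((Set.pairwise_disjoint_Ico_intCast ℝ) hij).mono Set.inter_subset_right
          Set.inter_subset_right) fun k => hB.inter measurableSet_Ico
      rw [← Set.inter_iUnion, iUnion_Ico_intCast, Set.inter_univ] at h
      rw [h]
      exact tsum_congr fun k => Measure.restrict_apply hB
    have hhas : HasSum (fun k => lam * (unif k B).toNNReal) (lam * (volume B).toNNReal) := by
      refine HasSum.mul_left _ ?_
      rw [← ENNReal.hasSum_coe, ENNReal.coe_toNNReal hB', ← hsum]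
      simp_rw [ENNReal.coe_toNNReal (measure_ne_top (unif _) B)]
      exact ENNReal.summable.hasSum
    refine (hasLaw_totalCount hm hind hlaw hhas).congr ?_
    filter_upwards [ae_mem_good lam] with ω hω using count_process hω B
  indep_count n B hB hd := by
    have hm : ∀ (i : Fin n) (k : ℤ), Measurable fun ω : Sample => sampleCount (B i) (ω k) :=
      fun i k => (measurable_sampleCount (hB i)).comp (measurable_pi_apply k)
    have h1 : iIndepFun (fun (k : ℤ) (ω : Sample) (i : Fin n) => sampleCount (B i) (ω k))
        (sampleLaw lam) :=
      iIndepFun_infinitePi (X := fun _ x i => sampleCount (B i) x) fun k =>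
        measurable_pi_lambda _ fun i => measurable_sampleCount (hB i)
    have h2 : ∀ k : ℤ, iIndepFun (fun (i : Fin n) (ω : Sample) => sampleCount (B i) (ω k))
        (sampleLaw lam) := fun k =>
      iIndepFun_comp_measurePreserving
        (measurePreserving_eval_infinitePi (fun k => sampleMeasure (unif k) lam) k)
        (fun i => measurable_sampleCount (hB i)) (iIndepFun_sampleCount (unif k) lam hB hd)
    have h3 := (iIndepFun_uncurry' (X := fun (k : ℤ) (i : Fin n) (ω : Sample) =>
      sampleCount (B i) (ω k)) (fun k i => hm i k) h1 h2).precomp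
        (Prod.swap_injective (α := Fin n) (β := ℤ))
    have h4 := iIndepFun_group (X := fun (i : Fin n) (k : ℤ) (ω : Sample) =>
      sampleCount (B i) (ω k)) hm h3
    refine (h4.comp (fun _ => totalCount) fun _ => measurable_totalCount).congr fun i => ?_
    filter_upwards [ae_mem_good lam] with ω hω using (count_process hω (B i)).symm

end PoissonConstruction

/-! ### Code lengths -/

section Gibbs

variable {Ω : Type*} [MeasurableSpace Ω] {P : Measure Ω} [IsProbabilityMeasure P]

lemma integrable_comp_finite {α : Type*} [Finite α] [MeasurableSpace α]
    [MeasurableSingletonClass α] {A : Ω → α} (hA : Measurable A) (f : α → ℝ) :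
    Integrable (fun ω => f (A ω)) P := by
  have := Measure.isProbabilityMeasure_map (μ := P) hA.aemeasurable
  exact (Integrable.of_finite (f := f) (μ := P.map A)).comp_measurable hA

lemma integral_comp_fintype {α : Type*} [Fintype α] [MeasurableSpace α]
    [MeasurableSingletonClass α] {A : Ω → α} (hA : Measurable A) (f : α → ℝ) :
    ∫ ω, f (A ω) ∂P = ∑ a, P.real (A ⁻¹' {a}) * f a := by
  have := Measure.isProbabilityMeasure_map (μ := P) hA.aemeasurable
  have hf : Measurable f := Measurable.of_discrete
  rw [← integral_map hA.aemeasurable hf.aestronglyMeasurable, integral_fintype .of_finite]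
  refine Finset.sum_congr rfl fun a _ => ?_
  rw [map_measureReal_apply hA (measurableSet_singleton a), smul_eq_mul]

lemma integral_comp_bool {b : Ω → Bool} (hb : Measurable b) (f : Bool → ℝ) :
    ∫ ω, f (b ω) ∂P = P.real {ω | b ω = true} * f true +
      (1 - P.real {ω | b ω = true}) * f false := by
  rw [integral_comp_fintype hb, Fintype.sum_bool]
  have h : P.real (b ⁻¹' {false}) = 1 - P.real (b ⁻¹' {true}) := by
    rw [← probReal_compl_eq_one_sub (hb (measurableSet_singleton true))]
    congr 1
    ext; simp
  rw [h]
  rfl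

/-- Gibbs' inequality: if the subprobability weights `q` describe the pair `(A, C)`, then the
expected code length `-log q(A, C)` is at least the entropy of `C`. -/
lemma integral_log_le_integral_log {α γ : Type*} [Fintype α] [Fintype γ] [MeasurableSpace α]
    [MeasurableSpace γ] [MeasurableSingletonClass α] [MeasurableSingletonClass γ]
    {A : Ω → α} {C : Ω → γ} (hA : Measurable A) (hC : Measurable C) {q : α → γ → ℝ}
    (hq : ∀ a c, 0 < q a c) (hsum : ∑ a, ∑ c, q a c ≤ 1) {p : γ → ℝ} (hp : ∀ c, 0 < p c)
    (hpC : ∀ c, P.real (C ⁻¹' {c}) = p c) :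
    ∫ ω, Real.log (q (A ω) (C ω)) ∂P ≤ ∫ ω, Real.log (p (C ω)) ∂P := by
  have hAC : Measurable fun ω => (A ω, C ω) := hA.prodMk hC
  have h1 := integrable_comp_finite (P := P) hAC fun x => Real.log (q x.1 x.2)
  have h2 := integrable_comp_finite (P := P) hC fun x => Real.log (p x)
  have h3 := integrable_comp_finite (P := P) hAC fun x => q x.1 x.2 / p x.2
  have hle : ∫ ω, (Real.log (q (A ω) (C ω)) - Real.log (p (C ω))) ∂P ≤
      ∫ ω, (q (A ω) (C ω) / p (C ω) - 1) ∂P := by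
    refine integral_mono (h1.sub h2) (h3.sub (integrable_const 1)) fun ω => ?_
    simp only
    rw [← Real.log_div (hq _ _).ne' (hp _).ne']
    exact Real.log_le_sub_one_of_pos (div_pos (hq _ _) (hp _))
  have h4 : ∫ ω, q (A ω) (C ω) / p (C ω) ∂P ≤ 1 := by
    rw [integral_comp_fintype hAC fun x => q x.1 x.2 / p x.2, Fintype.sum_prod_type]
    refine le_trans (Finset.sum_le_sum fun a _ => Finset.sum_le_sum fun c _ => ?_) hsum
    have : P.real ((fun ω => (A ω, C ω)) ⁻¹' {(a, c)}) ≤ p c := by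
      rw [← hpC c]
      refine measureReal_mono fun ω hω => ?_
      simp only [Set.mem_preimage, Set.mem_singleton_iff, Prod.mk.injEq] at hω ⊢
      exact hω.2
    calc _ ≤ p c * (q a c / p c) := mul_le_mul_of_nonneg_right this (div_pos (hq _ _) (hp _)).le
      _ = q a c := mul_div_cancel₀ _ (hp c).ne'
  rw [integral_sub h1 h2, integral_sub h3 (integrable_const 1)] at hle
  simp only [integral_const, probReal_univ, smul_eq_mul, mul_one] at hle
  linarith

end Gibbs

/-- The weight of a predicted bit `b`, when the prediction `g` is trusted up to error `δ`. -/
noncomputable def predWeight (δ : ℝ) (g b : Bool) : ℝ := if b = g then 1 - δ else δ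

/-- The bit telling whether some bit of `c` is set. -/
def anyBit {n : ℕ} (c : Fin n → Bool) : Bool := decide (∃ i, c i = true)

/-- The weight of a bit `c` when it is expected to agree with `u`, at a cost `log n` for each
disagreement. -/
noncomputable def flipWeight (n : ℕ) (u c : Bool) : ℝ := if u = c then 1 else (n : ℝ)⁻¹

/-- The weight of the bits `c` of one block, given the bits `u` that they extend and a prediction
`g` of whether the block is occupied. The factor `exp (-1)` makes up for the total flip weight of an
occupied block, which is `(1 + 1 / n) ^ n`. -/
noncomputable def blockWeight {n : ℕ} (δ : ℝ) (g : Bool) (u c : Fin n → Bool) : ℝ :=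
  predWeight δ g (anyBit c) * (if anyBit c then Real.exp (-1) else 1) * ∏ i, flipWeight n (u i) (c i)

lemma predWeight_pos {δ : ℝ} (h0 : 0 < δ) (h1 : δ < 1) (g b : Bool) : 0 < predWeight δ g b := by
  unfold predWeight; split_ifs <;> linarith

lemma flipWeight_pos {n : ℕ} (hn : 0 < n) (u c : Bool) : 0 < flipWeight n u c := by
  unfold flipWeight; split_ifs <;> positivity

lemma blockWeight_pos {n : ℕ} (hn : 0 < n) {δ : ℝ} (h0 : 0 < δ) (h1 : δ < 1) (g : Bool)
    (u c : Fin n → Bool) : 0 < blockWeight δ g u c := by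
  have := predWeight_pos h0 h1 g (anyBit c)
  have := Finset.prod_pos fun i (_ : i ∈ Finset.univ) => flipWeight_pos hn (u i) (c i)
  unfold blockWeight
  split_ifs <;> positivity

lemma sum_prod_eq_prod_sum {ι : Type*} [Fintype ι] [DecidableEq ι] {κ : Type*} [Fintype κ]
    (F : ι → κ → ℝ) : ∑ c : ι → κ, ∏ i, F i (c i) = ∏ i, ∑ b, F i b := by
  rw [Finset.prod_univ_sum, Fintype.piFinset_univ]

lemma sum_blockWeight_le {n : ℕ} (hn : 0 < n) {δ : ℝ} (h0 : 0 < δ) (h1 : δ < 1) (g : Bool)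
    (u : Fin n → Bool) : ∑ c, blockWeight δ g u c ≤ 1 := by
  have hn1 : (n : ℝ)⁻¹ ≤ 1 := inv_le_one_of_one_le₀ (by exact_mod_cast hn)
  have hflip : ∑ c : Fin n → Bool, ∏ i, flipWeight n (u i) (c i) ≤ Real.exp 1 := by
    rw [sum_prod_eq_prod_sum fun i b => flipWeight n (u i) b]
    have : ∀ i, ∑ b, flipWeight n (u i) b = 1 + (n : ℝ)⁻¹ := by
      intro i
      rw [Fintype.sum_bool]
      cases u i <;> simp [flipWeight, add_comm]
    simp_rw [this]
    rw [Finset.prod_const, Finset.card_univ, Fintype.card_fin]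
    calc (1 + (n : ℝ)⁻¹) ^ n ≤ (Real.exp (n : ℝ)⁻¹) ^ n := by
          gcongr; rw [add_comm]; exact Real.add_one_le_exp _
      _ = Real.exp 1 := by
          rw [← Real.exp_nat_mul, mul_inv_cancel₀ (by positivity)]
  have hpt : ∀ c : Fin n → Bool, blockWeight δ g u c ≤
      (if c = fun _ => false then predWeight δ g false else 0) +
        predWeight δ g true * Real.exp (-1) * ∏ i, flipWeight n (u i) (c i) := by
    intro c
    have hprod := Finset.prod_pos fun i (_ : i ∈ Finset.univ) => flipWeight_pos hn (u i) (c i)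
    have hf := predWeight_pos h0 h1 g false
    have ht := predWeight_pos h0 h1 g true
    by_cases hc : c = fun _ => false
    · have hany : anyBit c = false := by simp [anyBit, hc]
      rw [blockWeight, hany, if_pos hc]
      have hle : ∏ i, flipWeight n (u i) (c i) ≤ 1 := Finset.prod_le_one
        (fun i _ => (flipWeight_pos hn _ _).le) fun i _ => by
          unfold flipWeight; split_ifs <;> linarith
      have : 0 ≤ predWeight δ g true * Real.exp (-1) * ∏ i, flipWeight n (u i) (c i) := by
        positivity
      simp only [Bool.false_eq_true, if_false, mul_one]
      nlinarith
    · have hany : anyBit c = true := by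
        by_contra h
        refine hc (funext fun i => ?_)
        simp only [anyBit, decide_eq_true_eq, not_exists, Bool.not_eq_true] at h
        exact h i
      rw [blockWeight, hany, if_neg hc]
      simp
  refine (Finset.sum_le_sum fun c _ => hpt c).trans ?_
  rw [Finset.sum_add_distrib, Finset.sum_ite_eq' Finset.univ, ← Finset.mul_sum,
    if_pos (Finset.mem_univ _)]
  have ht := predWeight_pos h0 h1 g true
  have h2 : predWeight δ g false + predWeight δ g true = 1 := by
    cases g <;> simp [predWeight]
  have h3 : Real.exp (-1) * ∑ c : Fin n → Bool, ∏ i, flipWeight n (u i) (c i) ≤ 1 := by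
    calc _ ≤ Real.exp (-1) * Real.exp 1 := by gcongr
      _ = 1 := by rw [← Real.exp_add]; simp
  nlinarith

lemma bernWeight_pos {r : ℝ} (h0 : 0 < r) (h1 : r < 1) (b : Bool) : 0 < bernWeight r b := by
  cases b <;> simp [bernWeight] <;> linarith

/-- The product weights, given by Bernoulli weights of the bits `a` and weights of the blocks of
`c` that may depend on `a`, are subprobability weights. -/
lemma sum_bernWeight_mul_blockWeight_le {ι : Type*} [Fintype ι] [DecidableEq ι] {K n : ℕ}
    (hn : 0 < n) {δ r : ℝ} (h0 : 0 < δ) (h1 : δ < 1) (hr0 : 0 < r) (hr1 : r < 1)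
    (g : Fin K → (ι → Bool) → Bool) (u : Fin K → (ι → Bool) → Fin n → Bool) :
    ∑ a : ι → Bool, ∑ c : Fin K → Fin n → Bool,
      (∏ i, bernWeight r (a i)) * ∏ k, blockWeight δ (g k a) (u k a) (c k) ≤ 1 := by
  have hle : ∀ a : ι → Bool, ∑ c : Fin K → Fin n → Bool,
      (∏ i, bernWeight r (a i)) * ∏ k, blockWeight δ (g k a) (u k a) (c k) ≤
        ∏ i, bernWeight r (a i) := by
    intro a
    rw [← Finset.mul_sum, sum_prod_eq_prod_sum fun k c => blockWeight δ (g k a) (u k a) c]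
    refine mul_le_of_le_one_right (Finset.prod_nonneg fun i _ => (bernWeight_pos hr0 hr1 _).le) ?_
    exact Finset.prod_le_one
      (fun k _ => Finset.sum_nonneg fun c _ => (blockWeight_pos hn h0 h1 _ _ _).le)
      fun k _ => sum_blockWeight_le hn h0 h1 _ _
  refine (Finset.sum_le_sum fun a _ => hle a).trans ?_
  rw [sum_prod_eq_prod_sum fun _ b => bernWeight r b]
  simp [bernWeight]

/-! ### The entropy inequality -/

/-- The negative of the entropy of a Bernoulli variable of parameter `r`. -/
noncomputable def negEntropy (r : ℝ) : ℝ := r * Real.log r + (1 - r) * Real.log (1 - r)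

lemma integral_log_bernWeight {Ω : Type*} [MeasurableSpace Ω] {P : Measure Ω}
    [IsProbabilityMeasure P] {b : Ω → Bool} (hb : Measurable b) {r : ℝ}
    (hr : P.real {ω | b ω = true} = r) :
    ∫ ω, Real.log (bernWeight r (b ω)) ∂P = negEntropy r := by
  rw [integral_comp_bool hb fun b => Real.log (bernWeight r b), hr]
  simp [bernWeight, negEntropy]

lemma integral_log_predWeight_ge {Ω : Type*} [MeasurableSpace Ω] {P : Measure Ω}
    [IsProbabilityMeasure P] {g b : Ω → Bool} (hg : Measurable g) (hb : Measurable b) {δ : ℝ}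
    (h0 : 0 < δ) (h1 : δ < 1) (h : P.real {ω | b ω ≠ g ω} ≤ δ) :
    Real.log (1 - δ) + δ * Real.log δ ≤ ∫ ω, Real.log (predWeight δ (g ω) (b ω)) ∂P := by
  have he : Measurable fun ω => b ω != g ω :=
    (Measurable.of_discrete (f := fun p : Bool × Bool => p.1 != p.2)).comp (hb.prodMk hg)
  have hpt : ∀ ω, Real.log (predWeight δ (g ω) (b ω)) =
      (fun e : Bool => cond e (Real.log δ) (Real.log (1 - δ))) (b ω != g ω) := by
    intro ω
    cases b ω <;> cases g ω <;> simp [predWeight]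
  simp_rw [hpt]
  rw [integral_comp_bool he fun e : Bool => cond e (Real.log δ) (Real.log (1 - δ))]
  have hset : {ω | (b ω != g ω) = true} = {ω | b ω ≠ g ω} := by ext; simp
  rw [hset]
  have hp0 : 0 ≤ P.real {ω | b ω ≠ g ω} := measureReal_nonneg
  have hl1 : Real.log δ ≤ 0 := Real.log_nonpos h0.le h1.le
  have hl2 : Real.log (1 - δ) ≤ 0 := Real.log_nonpos (by linarith) (by linarith)
  simp only [cond_true, cond_false]
  nlinarith

lemma log_blockWeight {n : ℕ} (hn : 0 < n) {δ : ℝ} (h0 : 0 < δ) (h1 : δ < 1) (g : Bool)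
    (u c : Fin n → Bool) : Real.log (blockWeight δ g u c) = Real.log (predWeight δ g (anyBit c)) -
      cond (anyBit c) 1 0 - ∑ i, Real.log n * cond (u i != c i) 1 0 := by
  have hp := predWeight_pos h0 h1 g (anyBit c)
  have hprod := Finset.prod_pos fun i (_ : i ∈ Finset.univ) => flipWeight_pos hn (u i) (c i)
  have he : (0 : ℝ) < if anyBit c then Real.exp (-1) else 1 := by split_ifs <;> positivity
  rw [blockWeight, Real.log_mul (by positivity) hprod.ne', Real.log_mul hp.ne' he.ne',
    Real.log_prod fun i _ => (flipWeight_pos hn _ _).ne', sub_eq_add_neg, sub_eq_add_neg,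
    ← Finset.sum_neg_distrib]
  congr 1
  · congr 1
    cases anyBit c <;> simp
  · refine Finset.sum_congr rfl fun i _ => ?_
    cases u i <;> cases c i <;> simp [flipWeight]

section EntropyInequality

open LocFinSet

variable {Ω : Type*} [MeasurableSpace Ω] {P : Measure Ω} [IsProbabilityMeasure P]
  {X Y : Ω → LocFinSet} {lam lam' : ℝ≥0}

lemma idx_injective {K n : ℕ} : Function.Injective
    fun p : Fin K × Fin n => ((p.1 : ℕ) * n + (p.2 : ℕ) : ℤ) := by
  rintro ⟨k, i⟩ ⟨l, m⟩ h
  have h' : (k : ℕ) * n + i = l * n + m := by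
    simp only at h
    exact_mod_cast h
  refine finProdFinEquiv.injective (Fin.ext ?_)
  simp only [finProdFinEquiv_apply_val]
  rw [mul_comm n, mul_comm n]
  omega

/-- The code length of the fine occupation bits of `X` and then of those of `Y`, given a
predictor `T` for the coarse occupation bits of `Y`, is at least the entropy of the fine occupation
bits of `Y`. Here `X ⊆ Y` are Poisson processes, and `K` coarse cells are considered. -/
lemma entropy_inequality (hX : IsPoissonProcess X lam P) (hY : IsPoissonProcess Y lam' P)
    (hlam : 0 < lam) (hlam' : 0 < lam') {ε : ℝ} (hε : 0 < ε)
    (hXY : ∀ η ω i, occ η (X ω) i = true → occ η (Y ω) i = true) {δ : ℝ} (hδ0 : 0 < δ)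
    (hδ1 : δ < 1) (j : ℕ) (T : Set (window j → Bool)) [DecidablePred (· ∈ T)]
    (hT : ∀ k : ℕ, P.real {ω | occ ε (Y ω) k ≠ decide ((fun i : window j =>
      occ (ε / 2 ^ j) (X ω) (i + k * 2 ^ j)) ∈ T)} ≤ δ) {r r' : ℝ}
    (hr : r = 1 - Real.exp (-(lam * (ε / 2 ^ j))))
    (hr' : r' = 1 - Real.exp (-(lam' * (ε / 2 ^ j)))) (K : ℕ) :
    (K + 2 * j) * 2 ^ j * negEntropy r + K * (Real.log (1 - δ) + δ * Real.log δ - lam' * ε -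
      2 ^ j * (Real.log (2 ^ j) * (r' - r))) ≤ K * 2 ^ j * negEntropy r' := by
  have hn : 0 < 2 ^ j := by positivity
  have hη : 0 < ε / 2 ^ j := by positivity
  have hrange : ∀ x : ℝ≥0, 0 < x → 0 < 1 - Real.exp (-(x * (ε / 2 ^ j))) ∧
      1 - Real.exp (-(x * (ε / 2 ^ j))) < 1 := by
    intro x hx
    have hx' : (0 : ℝ) < x := hx
    have h1 : Real.exp (-(x * (ε / 2 ^ j))) < 1 := Real.exp_lt_one_iff.2 (by
      have := mul_pos hx' hη; linarith)
    have h2 := Real.exp_pos (-(x * (ε / 2 ^ j)))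
    constructor <;> linarith
  obtain ⟨hr0, hr1⟩ := hr ▸ hrange lam hlam
  obtain ⟨hr0', hr1'⟩ := hr' ▸ hrange lam' hlam'
  -- The predictors of the `K` coarse cells look at `j` further coarse cells to either side.
  let W : Finset ℤ := Finset.Ico (-(j * 2 ^ j : ℤ)) ((K + j) * 2 ^ j)
  let A : Ω → W → Bool := fun ω i => occ (ε / 2 ^ j) (X ω) i
  let C : Ω → Fin K → Fin (2 ^ j) → Bool := fun ω k i =>
    occ (ε / 2 ^ j) (Y ω) ((k : ℕ) * (2 ^ j : ℕ) + (i : ℕ))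
  let ext : (W → Bool) → ℤ → Bool := fun a z => if h : z ∈ W then a ⟨z, h⟩ else false
  let g : Fin K → (W → Bool) → Bool := fun k a =>
    decide ((fun i : window j => ext a (i + (k : ℕ) * 2 ^ j)) ∈ T)
  let u : Fin K → (W → Bool) → Fin (2 ^ j) → Bool := fun k a i =>
    ext a ((k : ℕ) * (2 ^ j : ℕ) + (i : ℕ))
  have hoccX : ∀ i, Measurable fun ω => occ (ε / 2 ^ j) (X ω) i := fun i =>
    (measurable_occ _ i).comp hX.measurable
  have hoccY : ∀ η i, Measurable fun ω => occ η (Y ω) i := fun η i =>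
    (measurable_occ _ i).comp hY.measurable
  have hA : Measurable A := measurable_pi_lambda _ fun i => hoccX i
  have hC : Measurable C := measurable_pi_lambda _ fun k => measurable_pi_lambda _ fun i => hoccY _ _
  have hext : ∀ ω, ∀ z ∈ W, ext (A ω) z = occ (ε / 2 ^ j) (X ω) z := by
    intro ω z hz
    simp only [ext, A, dif_pos hz]
  have hpz : (0 : ℤ) < 2 ^ j := by positivity
  have hu : ∀ k ω i, u k (A ω) i = occ (ε / 2 ^ j) (X ω) ((k : ℕ) * (2 ^ j : ℕ) + (i : ℕ)) := by
    intro k ω i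
    refine hext ω _ (Finset.mem_Ico.2 ⟨?_, ?_⟩)
    · have : (0 : ℤ) ≤ j * 2 ^ j := by positivity
      have : (0 : ℤ) ≤ (k : ℕ) * (2 ^ j : ℕ) + (i : ℕ) := by positivity
      linarith
    · have hk : ((k : ℕ) : ℤ) + 1 ≤ K := by exact_mod_cast k.2
      have hi : ((i : ℕ) : ℤ) < 2 ^ j := by exact_mod_cast i.2
      have hj : (0 : ℤ) ≤ j := by positivity
      push_cast
      nlinarith
  have hg : ∀ k ω, g k (A ω) = decide ((fun i : window j =>
      occ (ε / 2 ^ j) (X ω) (i + (k : ℕ) * 2 ^ j)) ∈ T) := by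
    intro k ω
    have : (fun i : window j => ext (A ω) (i + (k : ℕ) * 2 ^ j)) =
        fun i : window j => occ (ε / 2 ^ j) (X ω) (i + (k : ℕ) * 2 ^ j) := by
      funext i
      have hi := Finset.mem_Ico.1 i.2
      have hk : ((k : ℕ) : ℤ) + 1 ≤ K := by exact_mod_cast k.2
      have hk0 : (0 : ℤ) ≤ (k : ℕ) := by positivity
      exact hext ω _ (Finset.mem_Ico.2 ⟨by nlinarith, by nlinarith⟩)
    simp only [g, this]
  have hany : ∀ k ω, anyBit (C ω k) = occ ε (Y ω) (k : ℕ) := by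
    intro k ω
    rw [Bool.eq_iff_iff, occ_eq_true_iff_exists hε hn]
    simp [anyBit, C]
  have hpX : ∀ i, P.real {ω | occ (ε / 2 ^ j) (X ω) i = true} = r := fun i => by
    rw [hX.measureReal_occ_eq hη, ← hr]; rfl
  have hpY : ∀ i, P.real {ω | occ (ε / 2 ^ j) (Y ω) i = true} = r' := fun i => by
    rw [hY.measureReal_occ_eq hη, ← hr']; rfl
  -- The law of the fine bits of `Y`.
  have hpC : ∀ c, P.real (C ⁻¹' {c}) = ∏ k, ∏ i, bernWeight r' (c k i) := by
    intro c
    have h := hY.measureReal_forall_occ_eq hη (idx_injective (K := K) (n := 2 ^ j))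
      fun p => c p.1 p.2
    rw [← hr', Fintype.prod_prod_type] at h
    rw [← h]
    congr 1
    ext ω
    simp only [Set.mem_preimage, Set.mem_singleton_iff, Set.mem_ofPred_eq, funext_iff, Prod.forall]
    rfl
  have hgibbs := integral_log_le_integral_log (P := P) hA hC
    (q := fun a c => (∏ i, bernWeight r (a i)) * ∏ k, blockWeight δ (g k a) (u k a) (c k))
    (fun a c => mul_pos (Finset.prod_pos fun i _ => bernWeight_pos hr0 hr1 _)
      (Finset.prod_pos fun k _ => blockWeight_pos hn hδ0 hδ1 _ _ _))
    (sum_bernWeight_mul_blockWeight_le hn hδ0 hδ1 hr0 hr1 g u)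
    (fun c => Finset.prod_pos fun k _ => Finset.prod_pos fun i _ => bernWeight_pos hr0' hr1' _) hpC
  -- The entropy of the fine bits of `Y`.
  have hright : ∫ ω, Real.log (∏ k, ∏ i, bernWeight r' (C ω k i)) ∂P =
      K * 2 ^ j * negEntropy r' := by
    have hlog : ∀ ω, Real.log (∏ k, ∏ i, bernWeight r' (C ω k i)) =
        ∑ k, ∑ i, Real.log (bernWeight r' (C ω k i)) := by
      intro ω
      rw [Real.log_prod fun k _ => (Finset.prod_pos fun i _ => bernWeight_pos hr0' hr1' _).ne']
      exact Finset.sum_congr rfl fun k _ =>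
        Real.log_prod fun i _ => (bernWeight_pos hr0' hr1' _).ne'
    simp_rw [hlog]
    have hint : ∀ k i, Integrable (fun ω => Real.log (bernWeight r' (C ω k i))) P := fun k i =>
      integrable_comp_finite (hoccY (ε / 2 ^ j) _) fun b => Real.log (bernWeight r' b)
    rw [integral_finsetSum _ fun k _ => integrable_finsetSum _ fun i _ => hint k i]
    simp_rw [integral_finsetSum _ fun i _ => hint _ i]
    have : ∀ k i, ∫ ω, Real.log (bernWeight r' (C ω k i)) ∂P = negEntropy r' := fun k i =>
      integral_log_bernWeight (hoccY _ _) (hpY _)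
    simp_rw [this]
    simp [mul_assoc]
  -- The code length of one block.
  have hblock : ∀ k, Real.log (1 - δ) + δ * Real.log δ - lam' * ε -
      2 ^ j * (Real.log (2 ^ j) * (r' - r)) ≤
        ∫ ω, Real.log (blockWeight δ (g k (A ω)) (u k (A ω)) (C ω k)) ∂P := by
    intro k
    simp_rw [log_blockWeight hn hδ0 hδ1, hany, hu]
    have hgm : Measurable fun ω => g k (A ω) :=
      (Measurable.of_discrete (f := g k)).comp hA
    have hne : ∀ i : Fin (2 ^ j), Measurable fun ω =>
        occ (ε / 2 ^ j) (X ω) ((k : ℕ) * (2 ^ j : ℕ) + (i : ℕ)) != C ω k i := fun i =>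
      (Measurable.of_discrete (f := fun p : Bool × Bool => p.1 != p.2)).comp
        ((hoccX _).prodMk (hoccY _ _))
    have hi1 : Integrable (fun ω => Real.log (predWeight δ (g k (A ω)) (occ ε (Y ω) (k : ℕ)))) P :=
      integrable_comp_finite (hgm.prodMk (hoccY ε (k : ℕ)))
        fun p : Bool × Bool => Real.log (predWeight δ p.1 p.2)
    have hi2 : Integrable (fun ω => cond (occ ε (Y ω) (k : ℕ)) (1 : ℝ) 0) P :=
      integrable_comp_finite (hoccY ε (k : ℕ)) fun b => cond b (1 : ℝ) 0
    have hi3 : ∀ i : Fin (2 ^ j), Integrable (fun ω => Real.log (2 ^ j : ℕ) *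
        cond (occ (ε / 2 ^ j) (X ω) ((k : ℕ) * (2 ^ j : ℕ) + (i : ℕ)) != C ω k i) (1 : ℝ) 0) P :=
      fun i => (integrable_comp_finite (hne i) fun b => cond b (1 : ℝ) 0).const_mul _
    have hi12 : Integrable (fun ω => Real.log (predWeight δ (g k (A ω)) (occ ε (Y ω) (k : ℕ))) -
      cond (occ ε (Y ω) (k : ℕ)) (1 : ℝ) 0) P := hi1.sub hi2
    rw [integral_sub hi12 (integrable_finsetSum _ fun i _ => hi3 i), integral_sub hi1 hi2,
      integral_finsetSum _ fun i _ => hi3 i]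
    have e1 := integral_log_predWeight_ge hgm (hoccY ε (k : ℕ)) hδ0 hδ1
      (by simpa only [hg] using hT k)
    have e2 : ∫ ω, cond (occ ε (Y ω) (k : ℕ)) (1 : ℝ) 0 ∂P ≤ lam' * ε := by
      rw [integral_comp_bool (hoccY ε (k : ℕ)) fun b => cond b (1 : ℝ) 0,
        hY.measureReal_occ_eq hε]
      have := Real.add_one_le_exp (-(lam' * ε))
      simp only [bernWeight, cond_true, cond_false]
      linarith
    have e3 : ∀ i : Fin (2 ^ j), ∫ ω, Real.log (2 ^ j : ℕ) *
        cond (occ (ε / 2 ^ j) (X ω) ((k : ℕ) * (2 ^ j : ℕ) + (i : ℕ)) != C ω k i) (1 : ℝ) 0 ∂P =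
          Real.log (2 ^ j) * (r' - r) := by
      intro i
      -- As `X ⊆ Y`, the disagreements are the fine cells that only `Y` occupies.
      have hpt : ∀ ω,
          cond (occ (ε / 2 ^ j) (X ω) ((k : ℕ) * (2 ^ j : ℕ) + (i : ℕ)) != C ω k i) (1 : ℝ) 0 =
            cond (C ω k i) 1 0 -
              cond (occ (ε / 2 ^ j) (X ω) ((k : ℕ) * (2 ^ j : ℕ) + (i : ℕ))) 1 0 := by
        intro ω
        have := hXY (ε / 2 ^ j) ω ((k : ℕ) * (2 ^ j : ℕ) + (i : ℕ))
        change _ → C ω k i = true at this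
        revert this
        cases C ω k i <;> cases occ (ε / 2 ^ j) (X ω) ((k : ℕ) * (2 ^ j : ℕ) + (i : ℕ)) <;> simp
      simp_rw [hpt]
      rw [integral_const_mul, integral_sub
        (integrable_comp_finite (hoccY _ _) fun b => cond b (1 : ℝ) 0)
        (integrable_comp_finite (hoccX _) fun b => cond b (1 : ℝ) 0),
        integral_comp_bool (hoccY _ _) fun b => cond b (1 : ℝ) 0,
        integral_comp_bool (hoccX _) fun b => cond b (1 : ℝ) 0, hpX, hpY]
      simp
    simp_rw [e3]
    rw [Finset.sum_const, Finset.card_univ, Fintype.card_fin, nsmul_eq_mul]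
    push_cast
    linarith
  have hleft : ∀ ω, Real.log ((∏ i, bernWeight r (A ω i)) *
      ∏ k, blockWeight δ (g k (A ω)) (u k (A ω)) (C ω k)) = (∑ i, Real.log (bernWeight r (A ω i))) +
        ∑ k, Real.log (blockWeight δ (g k (A ω)) (u k (A ω)) (C ω k)) := by
    intro ω
    rw [Real.log_mul (Finset.prod_pos fun i _ => bernWeight_pos hr0 hr1 _).ne'
      (Finset.prod_pos fun k _ => blockWeight_pos hn hδ0 hδ1 _ _ _).ne',
      Real.log_prod fun i _ => (bernWeight_pos hr0 hr1 _).ne',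
      Real.log_prod fun k _ => (blockWeight_pos hn hδ0 hδ1 _ _ _).ne']
  have hiA : ∀ i, Integrable (fun ω => Real.log (bernWeight r (A ω i))) P := fun i =>
    integrable_comp_finite (hoccX i) fun b => Real.log (bernWeight r b)
  have hiB : ∀ k, Integrable
      (fun ω => Real.log (blockWeight δ (g k (A ω)) (u k (A ω)) (C ω k))) P := fun k =>
    integrable_comp_finite (hA.prodMk hC)
      fun x => Real.log (blockWeight δ (g k x.1) (u k x.1) (x.2 k))
  have hcard : (Fintype.card W : ℝ) = (K + 2 * j) * 2 ^ j := by
    have : Fintype.card W = (K + 2 * j) * 2 ^ j := by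
      have h : ((K + j) * 2 ^ j - -(j * 2 ^ j) : ℤ) = ((K + 2 * j) * 2 ^ j : ℕ) := by
        push_cast; ring
      rw [Fintype.card_coe, Int.card_Ico, h, Int.toNat_natCast]
    rw [this]; push_cast; ring
  have hintA : ∀ i : W, ∫ ω, Real.log (bernWeight r (A ω i)) ∂P = negEntropy r := fun i =>
    integral_log_bernWeight (hoccX i) (hpX i)
  simp_rw [hleft] at hgibbs
  rw [hright, integral_add (integrable_finsetSum _ fun i _ => hiA i)
    (integrable_finsetSum _ fun k _ => hiB k), integral_finsetSum _ fun i _ => hiA i,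
    integral_finsetSum _ fun k _ => hiB k] at hgibbs
  simp_rw [hintA] at hgibbs
  rw [Finset.sum_const, Finset.card_univ, nsmul_eq_mul, hcard] at hgibbs
  have hB := Finset.card_nsmul_le_sum Finset.univ _ _ fun k _ => hblock k
  rw [Finset.card_univ, Fintype.card_fin, nsmul_eq_mul] at hB
  linarith

end EntropyInequality

/-! ### Asymptotics on fine grids -/

open Filter Topology in
lemma tendsto_mul_one_sub_exp {a : ℝ} (ha : 0 < a) :
    Tendsto (fun j : ℕ => (2 : ℝ) ^ j * (1 - Real.exp (-(a / 2 ^ j)))) atTop (𝓝 a) := by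
  have hd : HasDerivAt (fun x : ℝ => 1 - Real.exp (-x)) 1 0 := by
    have := ((hasDerivAt_id (0 : ℝ)).neg.exp).const_sub 1
    simpa using this
  have ht : Tendsto (fun j : ℕ => a / (2 : ℝ) ^ j) atTop (𝓝[≠] 0) := by
    refine tendsto_nhdsWithin_iff.2 ⟨tendsto_const_nhds.div_atTop
      (tendsto_pow_atTop_atTop_of_one_lt (by norm_num)), .of_forall fun j => ?_⟩
    have : 0 < a / (2 : ℝ) ^ j := by positivity
    exact this.ne'
  have h := ((hasDerivAt_iff_tendsto_slope_zero.1 hd).comp ht).const_mul a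
  rw [mul_one] at h
  refine h.congr fun j => ?_
  simp only [Function.comp_apply, zero_add, neg_zero, Real.exp_zero, sub_self, sub_zero,
    smul_eq_mul, inv_div]
  field_simp

open Filter Topology in
/-- The entropy of `2 ^ j` independent bits that fail to be set with probability `exp (-a / 2 ^ j)`
grows like `a log (2 ^ j)`, up to a convergent term. -/
lemma tendsto_negEntropy {a : ℝ} (ha : 0 < a) :
    Tendsto (fun j : ℕ => (2 : ℝ) ^ j * negEntropy (1 - Real.exp (-(a / 2 ^ j))) +
      2 ^ j * (1 - Real.exp (-(a / 2 ^ j))) * Real.log (2 ^ j)) atTop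
      (𝓝 (a * Real.log a - a)) := by
  have h1 := tendsto_mul_one_sub_exp ha
  have h2 := (Real.continuous_mul_log.tendsto a).comp h1
  have h3 : Tendsto (fun j : ℕ => Real.exp (-(a / (2 : ℝ) ^ j)) * a) atTop (𝓝 a) := by
    have h0 : Tendsto (fun j : ℕ => -(a / (2 : ℝ) ^ j)) atTop (𝓝 0) := by
      have : Tendsto (fun j : ℕ => a / (2 : ℝ) ^ j) atTop (𝓝 0) := tendsto_const_nhds.div_atTop
        (tendsto_pow_atTop_atTop_of_one_lt (by norm_num))
      simpa using this.neg
    simpa using ((Real.continuous_exp.tendsto 0).comp h0).mul_const a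
  refine (h2.sub h3).congr fun j => ?_
  have hpow : (0 : ℝ) < 2 ^ j := by positivity
  have hr : 0 < 1 - Real.exp (-(a / 2 ^ j)) := by
    have : Real.exp (-(a / 2 ^ j)) < 1 := Real.exp_lt_one_iff.2 (by
      have : 0 < a / (2 : ℝ) ^ j := by positivity
      linarith)
    linarith
  simp only [Function.comp_apply, negEntropy]
  rw [Real.log_mul hpow.ne' hr.ne', sub_sub_cancel, Real.log_exp]
  field_simp
  ring

open Filter Topology in
lemma exists_lt_log_add_mul_log {ε : ℝ} (hε : 0 < ε) :
    ∃ δ : ℝ, 0 < δ ∧ δ < 1 ∧ -ε < Real.log (1 - δ) + δ * Real.log δ := by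
  have hc : ContinuousAt (fun δ : ℝ => Real.log (1 - δ) + δ * Real.log δ) 0 :=
    ((continuousAt_const.sub continuousAt_id).log (by simp)).add
      Real.continuous_mul_log.continuousAt
  have h1 : ∀ᶠ δ in 𝓝[>] (0 : ℝ), -ε < Real.log (1 - δ) + δ * Real.log δ :=
    nhdsWithin_le_nhds (hc.eventually (lt_mem_nhds (by simpa using hε)))
  have h2 : ∀ᶠ δ in 𝓝[>] (0 : ℝ), δ ∈ Set.Ioo (0 : ℝ) 1 := Ioo_mem_nhdsGT one_pos
  obtain ⟨δ, h, h'⟩ := (h1.and h2).exists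
  exact ⟨δ, h'.1, h'.2, h⟩

lemma nonpos_of_forall_natCast_mul_le {x y : ℝ} (h : ∀ K : ℕ, K * x ≤ y) : x ≤ 0 := by
  by_contra! hx
  obtain ⟨K, hK⟩ := exists_nat_gt (y / x)
  rw [div_lt_iff₀ hx] at hK
  linarith [h K]

/-! ### Equivariant thickenings -/

open LocFinSet in
open LocFinSet in
/-- By equivariance and stationarity, one predictor of the occupation of a coarse cell of
`X ∪ f(X)` from nearby fine occupation bits of `X` serves all coarse cells. -/
lemma exists_predictor {f : LocFinSet → LocFinSet} (hf : Measurable f) (hequi : IsEquivariant f)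
    {Ω : Type*} [MeasurableSpace Ω] {P : Measure Ω} [IsProbabilityMeasure P] {X : Ω → LocFinSet}
    {lam : ℝ≥0} (hX : IsPoissonProcess X lam P) {ε : ℝ} (hε : 0 < ε) {δ : ℝ} (hδ : 0 < δ) :
    ∃ j₀, ∀ j ≥ j₀, ∃ T : Set (window j → Bool), ∀ (_ : DecidablePred (· ∈ T)) (k : ℕ),
      P.real {ω | occ ε (X ω ∪ f (X ω)) k ≠ decide ((fun i : window j =>
        occ (ε / 2 ^ j) (X ω) (i + k * 2 ^ j)) ∈ T)} ≤ δ := by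
  have := Measure.isProbabilityMeasure_map (μ := P) hX.measurable.aemeasurable
  have hE : MeasurableSet {S : LocFinSet | occ ε (S ∪ f S) 0 = true} := by
    simp_rw [occ_union]
    exact ((Measurable.of_discrete (f := fun p : Bool × Bool => p.1 || p.2)).comp
      ((measurable_occ ε 0).prodMk ((measurable_occ ε 0).comp hf))) (measurableSet_singleton true)
  obtain ⟨j₀, hj₀⟩ := exists_bits_approx hε (P.map X) hE hδ
  refine ⟨j₀, fun j hj => ?_⟩
  obtain ⟨T, hT⟩ := hj₀ j hj
  refine ⟨T, fun _ k => ?_⟩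
  have hD : MeasurableSet (symmDiff {S : LocFinSet | occ ε (S ∪ f S) 0 = true} (bits ε j ⁻¹' T)) :=
    hE.symmDiff (measurable_bits ε j (Set.toFinite T).measurableSet)
  have hXk := hX.shift (-((k : ℤ) * ε))
  rw [hX.map_eq hXk, map_measureReal_apply hXk.measurable hD] at hT
  refine le_trans (le_of_eq ?_) hT.le
  congr 1
  ext ω
  have hfs : f ((X ω).shift (-((k : ℤ) * ε))) = (f (X ω)).shift (-((k : ℤ) * ε)) :=
    (congrFun (hequi (-((k : ℤ) * ε))) (X ω)).symm
  have hb : bits ε j ((X ω).shift (-((k : ℤ) * ε))) =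
      fun i : window j => occ (ε / 2 ^ j) (X ω) (i + k * 2 ^ j) := by
    funext i
    have hk : ((k : ℤ) : ℝ) * ε = ((k * 2 ^ j : ℤ) : ℝ) * (ε / 2 ^ j) := by
      push_cast; field_simp
    rw [bits, hk, occ_shift]
  have hy : occ ε ((X ω).shift (-((k : ℤ) * ε)) ∪ f ((X ω).shift (-((k : ℤ) * ε)))) 0 =
      occ ε (X ω ∪ f (X ω)) k := by
    rw [hfs, ← shift_union, occ_shift, zero_add]
  simp only [Set.mem_preimage, Set.mem_symmDiff, Set.mem_ofPred_eq, hy, hb]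
  by_cases h1 : (fun i : window j => occ (ε / 2 ^ j) (X ω) (i + k * 2 ^ j)) ∈ T <;>
  cases h2 : occ ε (X ω ∪ f (X ω)) k <;> simp [h1]

theorem theorem1 (lam lam' : ℝ≥0) (hlam : 0 < lam) (hlam' : lam < lam') :
    ¬ ∃ f : LocFinSet → LocFinSet, IsThickening f lam lam' ∧ IsEquivariant f := by
  classical
  rintro ⟨f, hf, hequi⟩
  have hX := PoissonConstruction.isPoissonProcess_process lam
  have hY := hf.isPoissonProcess _ _ _ hX
  have hl : (0 : ℝ) < lam := hlam
  have hl' : (0 : ℝ) < lam' := hlam.trans hlam'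
  have hll : (0 : ℝ) < lam' - lam := sub_pos.2 hlam'
  -- A coarse mesh `ε` for which the inequality between code length and entropy will fail.
  obtain ⟨ε, hε, hεlt⟩ : ∃ ε : ℝ, 0 < ε ∧ (lam' - lam) * Real.log ε +
      (lam' * Real.log lam' - lam * Real.log lam + lam) < -1 := by
    refine ⟨Real.exp ((-2 - (lam' * Real.log lam' - lam * Real.log lam + lam)) / (lam' - lam)),
      Real.exp_pos _, ?_⟩
    rw [Real.log_exp, mul_div_cancel₀ _ hll.ne']
    linarith
  obtain ⟨δ, hδ0, hδ1, hδ⟩ := exists_lt_log_add_mul_log hε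
  obtain ⟨j₀, hj₀⟩ := exists_predictor hf.measurable hequi hX hε hδ0
  have hXY : ∀ η (ω : PoissonConstruction.Sample) i,
      LocFinSet.occ η (PoissonConstruction.process ω) i = true →
        LocFinSet.occ η (PoissonConstruction.process ω ∪ f (PoissonConstruction.process ω)) i = true := by
    intro η ω i h
    rw [LocFinSet.occ_union, h, Bool.true_or]
  -- The inequality per coarse cell, in the limit of many coarse cells.
  have hineq : ∀ᶠ j : ℕ in Filter.atTop,
      2 ^ j * negEntropy (1 - Real.exp (-(lam * ε / 2 ^ j))) +
        2 ^ j * (1 - Real.exp (-(lam * ε / 2 ^ j))) * Real.log (2 ^ j) +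
        (Real.log (1 - δ) + δ * Real.log δ - lam' * ε) ≤
      2 ^ j * negEntropy (1 - Real.exp (-(lam' * ε / 2 ^ j))) +
        2 ^ j * (1 - Real.exp (-(lam' * ε / 2 ^ j))) * Real.log (2 ^ j) := by
    filter_upwards [Filter.eventually_ge_atTop j₀] with j hj
    obtain ⟨T, hT⟩ := hj₀ j hj
    have key := entropy_inequality hX hY hlam (hlam.trans hlam') hε hXY hδ0 hδ1 j T
      (hT (Classical.decPred _)) rfl rfl
    simp only [← mul_div_assoc] at key
    rw [← sub_nonpos]
    refine nonpos_of_forall_natCast_mul_le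
      (y := -(2 * j * 2 ^ j * negEntropy (1 - Real.exp (-(lam * ε / 2 ^ j))))) fun K => ?_
    have := key K
    linarith
  have hlim := le_of_tendsto_of_tendsto
    ((tendsto_negEntropy (mul_pos hl hε)).add_const (Real.log (1 - δ) + δ * Real.log δ - lam' * ε))
    (tendsto_negEntropy (mul_pos hl' hε)) hineq
  rw [Real.log_mul hl.ne' hε.ne', Real.log_mul hl'.ne' hε.ne'] at hlim
  nlinarith [mul_lt_mul_of_pos_right hεlt hε]
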